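/- Let $\mathcal L$ be the twisted Heisenberg–Virasoro algebra: the complex Lie algebra with basis $L(m), I(m)$ ($m\in\mathbb Z$), $C_L, C_I, C_{LI}$ and brackets $$[L(m),L(n)]=(n-m)L(m+n)+\delta_{m+n,0}\tfrac{m^3-m}{12}C_L,\qquad [I(m),I(n)]=n\,\delta_{m+n,0}C_I,$$ $$[L(m),I(n)]=n\,I(m+n)+\delta_{m+n,0}(m^2-m)C_{LI},$$ with $C_L, C_I, C_{LI}$ central. It is $\mathbb Z$-graded: $\mathcal L_m$ is spanned by $L(m), I(m)$ and, if $m=0$, also by $C_L, C_I, C_{LI}$. **Theorem.** Let $V$ be an indecomposable $\mathcal L$-module (nonzero, and not a direct sum of two nonzero submodules) with a $\mathbb C$-basis $(v_m)_{m\in\mathbb Z}$ such that $\mathcal L_m v_n\subset\mathbb C v_{m+n}$ for all $m,n\in\mathbb Z$. Then $V$ is isomorphic, as an $\mathcal L$-module, to one of the following modules for suitable $a,b,c,d\in\mathbb C$. Each of them has basis $(v_t)_{t\in\mathbb Z}$, the elements $C_L, C_I, C_{LI}$ act on it by $0$, and for all $n,t\in\mathbb Z$: 1. $\mathcal A_{a,b,c}$: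 $L(n)v_t=(a+t+bn)v_{n+t}$, $\ I(n)v_t=c\,v_{n+t}$; 2. $\mathcal A(a,d)$: $L(n)v_t=(t+n)v_{n+t}$ if $t\neq0$, $L(n)v_0=n(n+a)v_n$, $\ I(n)v_t=0$ if $t\ne0$, $I(n)v_0=dn\,v_n$; 3. $\mathcal B(a,d)$: $L(n)v_t=t\,v_{n+t}$ if $n+t\neq0$, $L(n)v_{-n}=-n(n+a)v_0$, $\ I(n)v_t=0$ if $n+t\ne0$, $I(n)v_{-n}=dn\,v_0$; 4. $\mathcal U_d$: $L(n)v_t=t\,v_{n+t}$, $\ I(n)v_t=0$ if $n+t\ne0$, $I(n)v_{-n}=dn\,v_0$; 5. $\mathcal V_d$: $L(n)v_t=(t+n)v_{n+t}$, $\ I(n)v_t=0$ if $t\ne0$, $I(n)v_0=dn\,v_n$; 6. $\tilde{\mathcal U}_d$ with $d\neq0$: $L(n)v_t=t\,v_{n+t}$ if $n+t\ne0$, $L(n)v_{-n}=0$, $\ I(n)v_t=0$ if $n+t\ne0$, $I(n)v_{-n}=dn\,v_0$; 7. $\tilde{\mathcal V}_c$ with $c\neq0$: $L(n)v_t=t\,v_{n+t}$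 if $n+t\ne0$, $L(n)v_{-n}=0$, $\ I(n)v_t=0$ if $t\ne0$ or $n=t=0$, $I(n)v_0=c\,v_n$ if $n\ne0$. In particular $C_L, C_I, C_{LI}$ act on $V$ by zero. -/

import Mathlib

noncomputable section

namespace TwistedHV

/-! ### The twisted Heisenberg–Virasoro algebra -/

/-- Labels of the standard basis `L(m), I(m), C_L, C_I, C_LI`. -/
inductive Gen : Type
  | L (m : ℤ)
  | I (m : ℤ)
  | CL
  | CI
  | CLI

/-- The underlying vector space of the twisted Heisenberg–Virasoro algebra: the free complex
vector space on `L(m), I(m), C_L, C_I, C_LI`. -/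
def HV : Type := Gen →₀ ℂ

instance : AddCommGroup HV := inferInstanceAs (AddCommGroup (Gen →₀ ℂ))
instance : Module ℂ HV := inferInstanceAs (Module ℂ (Gen →₀ ℂ))

/-- The basis vector with a given label. -/
def gen (g : Gen) : HV := Finsupp.single g (1 : ℂ)

/-- The brackets of the basis vectors. -/
def genBracket : Gen → Gen → HV
  | .L m, .L n => ((n : ℂ) - m) • gen (.L (m + n)) +
      if m + n = 0 then (((m : ℂ) ^ 3 - m) / 12) • gen .CL else 0
  | .I m, .I n => if m + n = 0 then (n : ℂ) • gen .CI else 0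
  | .L m, .I n => (n : ℂ) • gen (.I (m + n)) +
      if m + n = 0 then ((m : ℂ) ^ 2 - m) • gen .CLI else 0
  | .I m, .L n => -((m : ℂ) • gen (.I (n + m)) +
      if n + m = 0 then ((n : ℂ) ^ 2 - n) • gen .CLI else 0)
  | _, _ => 0

/-- The linear map on `HV` with prescribed values on the basis. -/
def lift {M : Type*} [AddCommGroup M] [Module ℂ M] (f : Gen → M) : HV →ₗ[ℂ] M :=
  (Finsupp.linearCombination ℂ f : (Gen →₀ ℂ) →ₗ[ℂ] M)

theorem lift_gen {M : Type*} [AddCommGroup M] [Module ℂ M] (f : Gen → M) (g : Gen) :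
    lift f (gen g) = f g :=
  (Finsupp.linearCombination_single ℂ (1 : ℂ) g).trans (one_smul ℂ (f g))

theorem hom_ext {M : Type*} [AddCommGroup M] [Module ℂ M] {f f' : HV →ₗ[ℂ] M}
    (h : ∀ g, f (gen g) = f' (gen g)) : f = f' :=
  Finsupp.lhom_ext' (M := ℂ) (φ := f) (ψ := f') fun g => LinearMap.ext_ring (h g)

theorem gen_induction {p : HV → Prop} (x : HV) (zero : p 0)
    (add : ∀ x y, p x → p y → p (x + y)) (smul : ∀ (c : ℂ) g, p (c • gen g)) : p x := by
  refine Finsupp.induction_linear x zero add fun g c => ?_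
  have h := smul c g
  have e : c • gen g = (Finsupp.single g c : Gen →₀ ℂ) :=
    (Finsupp.smul_single c g (1 : ℂ)).trans (by rw [smul_eq_mul, mul_one])
  rwa [e] at h

/-- The bilinear extension of `genBracket`. -/
def bracketMap : HV →ₗ[ℂ] HV →ₗ[ℂ] HV := lift fun g => lift (genBracket g)

theorem bracketMap_gen (g h : Gen) : bracketMap (gen g) (gen h) = genBracket g h := by
  simp [bracketMap, lift_gen]

theorem bracketMap_skew (x y : HV) : bracketMap x y = -bracketMap y x := by
  have key : bracketMap = -bracketMap.flip := by
    refine hom_ext fun g => hom_ext fun h => ?_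
    simp only [LinearMap.neg_apply, LinearMap.flip_apply, bracketMap_gen]
    rcases g with m | m | _ | _ | _ <;> rcases h with n | n | _ | _ | _ <;>
      simp only [genBracket, neg_zero, neg_neg]
    · rw [add_comm n m]
      split_ifs with h
      · obtain rfl : n = -m := by omega
        push_cast
        module
      · module
    · rw [add_comm n m]
      split_ifs with h
      · obtain rfl : n = -m := by omega
        push_cast
        module
      · simp
  exact congrArg (fun f => f x y) key

theorem bracketMap_jacobi (x y z : HV) :
    bracketMap x (bracketMap y z) =
      bracketMap (bracketMap x y) z + bracketMap y (bracketMap x z) := by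
  have gens : ∀ g h k : Gen, bracketMap (gen g) (genBracket h k) =
      bracketMap (genBracket g h) (gen k) + bracketMap (gen h) (genBracket g k) := by
    intro g h k
    rcases g with m | m | _ | _ | _ <;> rcases h with n | n | _ | _ | _ <;>
      rcases k with p | p | _ | _ | _ <;>
      simp only [genBracket, map_add, map_smul, map_neg, map_zero, LinearMap.add_apply,
        LinearMap.smul_apply, LinearMap.neg_apply, LinearMap.zero_apply, bracketMap_gen,
        apply_ite bracketMap, apply_ite (bracketMap _), add_zero, smul_zero, neg_zero,
        ite_self, DFunLike.ite_apply]
    all_goals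
      simp only [← add_assoc, add_comm n m, add_comm p m, add_comm p n, add_right_comm m p n,
        show n + p + m = m + n + p by ring]
      split_ifs with h
      · obtain rfl : p = -m - n := by omega
        push_cast
        module
      · push_cast
        module
  induction x using gen_induction with
  | zero => simp
  | add x x' hx hx' =>
    simp only [map_add, LinearMap.add_apply, hx, hx']
    abel
  | smul a g =>
    induction y using gen_induction with
    | zero => simp
    | add y y' hy hy' =>
      simp only [map_add, LinearMap.add_apply, hy, hy']
      abel
    | smul b h =>
      induction z using gen_induction with
      | zero => simp
      | add z z' hz hz' =>
        simp only [map_add, hz, hz']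
        abel
      | smul c k =>
        simp only [map_smul, LinearMap.smul_apply, bracketMap_gen, gens g h k]
        module

instance : LieRing HV where
  bracket x y := bracketMap x y
  add_lie x y z := by
    change bracketMap _ _ = bracketMap _ _ + bracketMap _ _
    simp
  lie_add x y z := by
    change bracketMap _ _ = bracketMap _ _ + bracketMap _ _
    simp
  lie_self x := by
    change bracketMap x x = 0
    have h2 : (2 : ℂ) • bracketMap x x = 0 := by
      rw [two_smul]
      nth_rewrite 1 [bracketMap_skew x x]
      exact neg_add_cancel _
    exact (smul_eq_zero.mp h2).resolve_left two_ne_zero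
  leibniz_lie x y z := bracketMap_jacobi x y z

instance : LieAlgebra ℂ HV where
  lie_smul c x y := by
    change bracketMap _ _ = c • bracketMap _ _
    simp

/-- The homogeneous component of degree `m`: it is spanned by `L(m)` and `I(m)`, and, if `m = 0`,
also by the central elements. -/
def component (m : ℤ) : Submodule ℂ HV :=
  Submodule.span ℂ ({gen (.L m), gen (.I m)} ∪
    {x | m = 0 ∧ (x = gen .CL ∨ x = gen .CI ∨ x = gen .CLI)})

/-- A module is indecomposable if it is nonzero and is not the direct sum of two nonzero
submodules. -/
def Indecomposable (V : Type*) [AddCommGroup V] [Module ℂ V] [LieRingModule HV V]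
    [LieModule ℂ HV V] : Prop :=
  Nontrivial V ∧ ∀ W₁ W₂ : LieSubmodule ℂ HV V, IsCompl W₁ W₂ → W₁ = ⊥ ∨ W₂ = ⊥

/-! ### Modules with basis `v_t`, `t ∈ ℤ`, on which the centre acts by zero -/

/-- Coefficients for which `L(n) v_t = l n t • v_{n+t}`, `I(n) v_t = i n t • v_{n+t}`,
`C_L = C_I = C_LI = 0` is a module over the twisted Heisenberg–Virasoro algebra. -/
structure Coeffs where
  l : ℤ → ℤ → ℂ
  i : ℤ → ℤ → ℂ
  hLL : ∀ m n t, l n t * l m (n + t) - l m t * l n (m + t) = ((n : ℂ) - m) * l (m + n) t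
  hLI : ∀ m n t, i n t * l m (n + t) - l m t * i n (m + t) = (n : ℂ) * i (m + n) t
  hII : ∀ m n t, i n t * i m (n + t) = i m t * i n (m + t)

/-- The module with basis `v_t`, `t ∈ ℤ`, given by the coefficients `k`. -/
def Coeffs.Mod (_k : Coeffs) : Type := ℤ →₀ ℂ

instance (k : Coeffs) : AddCommGroup k.Mod := inferInstanceAs (AddCommGroup (ℤ →₀ ℂ))
instance (k : Coeffs) : Module ℂ k.Mod := inferInstanceAs (Module ℂ (ℤ →₀ ℂ))

/-- The basis vector `v_t`. -/
def Coeffs.vec (k : Coeffs) (t : ℤ) : k.Mod := Finsupp.single t (1 : ℂ)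

/-- The linear endomorphism with prescribed values on the basis `v_t`. -/
def Coeffs.lift (k : Coeffs) (f : ℤ → k.Mod) : k.Mod →ₗ[ℂ] k.Mod :=
  (Finsupp.linearCombination ℂ f : (ℤ →₀ ℂ) →ₗ[ℂ] k.Mod)

theorem Coeffs.lift_vec (k : Coeffs) (f : ℤ → k.Mod) (t : ℤ) : k.lift f (k.vec t) = f t :=
  (Finsupp.linearCombination_single ℂ (1 : ℂ) t).trans (one_smul ℂ (f t))

theorem Coeffs.hom_ext (k : Coeffs) {f f' : k.Mod →ₗ[ℂ] k.Mod}
    (h : ∀ t, f (k.vec t) = f' (k.vec t)) : f = f' :=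
  Finsupp.lhom_ext' (M := ℂ) (φ := f) (ψ := f') fun t => LinearMap.ext_ring (h t)

/-- The action of the basis vectors of the algebra. -/
def Coeffs.genAct (k : Coeffs) : Gen → Module.End ℂ k.Mod
  | .L n => k.lift fun t => k.l n t • k.vec (n + t)
  | .I n => k.lift fun t => k.i n t • k.vec (n + t)
  | _ => 0

/-- The action of the algebra. -/
def Coeffs.act (k : Coeffs) : HV →ₗ[ℂ] Module.End ℂ k.Mod := TwistedHV.lift k.genAct

theorem Coeffs.act_gen (k : Coeffs) (g : Gen) : k.act (gen g) = k.genAct g :=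
  TwistedHV.lift_gen _ _

theorem Coeffs.act_bracket (k : Coeffs) (x y : HV) :
    k.act ⁅x, y⁆ = k.act x * k.act y - k.act y * k.act x := by
  change k.act (bracketMap x y) = _
  have gens : ∀ g h : Gen, k.act (genBracket g h) =
      k.genAct g * k.genAct h - k.genAct h * k.genAct g := by
    intro g h
    refine k.hom_ext fun t => ?_
    rcases g with m | m | _ | _ | _ <;> rcases h with n | n | _ | _ | _ <;>
      simp only [genBracket, map_add, map_smul, map_neg, map_zero, LinearMap.add_apply,
        LinearMap.smul_apply, LinearMap.neg_apply, LinearMap.zero_apply, LinearMap.sub_apply,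
        Module.End.mul_apply, Coeffs.act_gen, Coeffs.genAct, Coeffs.lift_vec, smul_smul,
        apply_ite k.act, add_zero, smul_zero, neg_zero, sub_zero, zero_mul, mul_zero, ite_self]
    · rw [add_left_comm n m t, ← sub_smul, add_assoc, k.hLL]
    · rw [add_left_comm n m t, ← sub_smul, add_assoc, k.hLI]
    · rw [add_left_comm n m t, ← sub_smul, ← neg_smul, add_assoc, ← k.hLI]
      congr 1
      · ring
      · rw [add_left_comm]
    · rw [add_left_comm n m t, ← sub_smul, k.hII, sub_self, zero_smul]
  induction x using gen_induction with
  | zero => simp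
  | add x x' hx hx' =>
    simp only [map_add, LinearMap.add_apply, hx, hx', add_mul, mul_add]
    abel
  | smul a g =>
    induction y using gen_induction with
    | zero => simp
    | add y y' hy hy' =>
      simp only [map_add, hy, hy', add_mul, mul_add]
      abel
    | smul b h =>
      simp only [map_smul, LinearMap.smul_apply, bracketMap_gen, gens g h, Coeffs.act_gen,
        smul_mul_assoc, mul_smul_comm, smul_sub, smul_comm a b]

instance (k : Coeffs) : LieRingModule HV k.Mod where
  bracket x v := k.act x v
  add_lie x y v := by
    simp
  lie_add x v w := by
    simp
  leibniz_lie x y v := by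
    change k.act x (k.act y v) = k.act ⁅x, y⁆ v + k.act y (k.act x v)
    simp [k.act_bracket]

instance (k : Coeffs) : LieModule ℂ HV k.Mod where
  smul_lie c x v := by
    change k.act _ _ = c • k.act _ _
    simp
  lie_smul c x v := by
    change k.act _ _ = c • k.act _ _
    simp

/-! ### The seven families -/

theorem cast_rel (m n t : ℤ) : (t = 0 → (t : ℂ) = 0) ∧ (m = 0 → (m : ℂ) = 0) ∧
    (n = 0 → (n : ℂ) = 0) ∧ (n + t = 0 → (n : ℂ) + t = 0) ∧ (m + t = 0 → (m : ℂ) + t = 0) ∧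
    (m + n + t = 0 → (m : ℂ) + n + t = 0) := by
  refine ⟨?_, ?_, ?_, ?_, ?_, ?_⟩ <;> intro h <;> exact_mod_cast h

/-- `𝒜_{a,b,c}`: `L(n) v_t = (a + t + b n) v_{n+t}`, `I(n) v_t = c v_{n+t}`. -/
def modA (a b c : ℂ) : Coeffs where
  l n t := a + t + b * n
  i _ _ := c
  hLL m n t := by push_cast; ring
  hLI m n t := by push_cast; ring
  hII m n t := by ring

/-- `𝒜(a,d)`: `L(n) v_t = (t + n) v_{n+t}` for `t ≠ 0`, `L(n) v_0 = n (n + a) v_n`,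
`I(n) v_t = 0` for `t ≠ 0`, `I(n) v_0 = d n v_n`. -/
def modAd (a d : ℂ) : Coeffs where
  l n t := if t = 0 then n * (n + a) else t + n
  i n t := if t = 0 then d * n else 0
  hLL m n t := by
    split_ifs <;> first
      | omega
      | (push_cast; ring1)
      | (have e := cast_rel m n t; push_cast; grind)
  hLI m n t := by
    split_ifs <;> first
      | omega
      | (push_cast; ring1)
      | (have e := cast_rel m n t; push_cast; grind)
  hII m n t := by
    split_ifs <;> first
      | omega
      | (push_cast; ring1)
      | (have e := cast_rel m n t; push_cast; grind)

/-- `ℬ(a,d)`: `L(n) v_t = t v_{n+t}` for `n + t ≠ 0`, `L(n) v_{-n} = -n (n + a) v_0`,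
`I(n) v_t = 0` for `n + t ≠ 0`, `I(n) v_{-n} = d n v_0`. -/
def modB (a d : ℂ) : Coeffs where
  l n t := if n + t = 0 then -n * (n + a) else t
  i n t := if n + t = 0 then d * n else 0
  hLL m n t := by
    split_ifs <;> first
      | omega
      | (push_cast; ring1)
      | (have e := cast_rel m n t; push_cast; grind)
  hLI m n t := by
    split_ifs <;> first
      | omega
      | (push_cast; ring1)
      | (have e := cast_rel m n t; push_cast; grind)
  hII m n t := by
    split_ifs <;> first
      | omega
      | (push_cast; ring1)
      | (have e := cast_rel m n t; push_cast; grind)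

/-- `𝒰_d`: `L(n) v_t = t v_{n+t}`, `I(n) v_t = 0` for `n + t ≠ 0`, `I(n) v_{-n} = d n v_0`. -/
def modU (d : ℂ) : Coeffs where
  l _ t := t
  i n t := if n + t = 0 then d * n else 0
  hLL m n t := by push_cast; ring
  hLI m n t := by
    split_ifs <;> first
      | omega
      | (push_cast; ring1)
      | (have e := cast_rel m n t; push_cast; grind)
  hII m n t := by
    split_ifs <;> first
      | omega
      | (push_cast; ring1)
      | (have e := cast_rel m n t; push_cast; grind)

/-- `𝒱_d`: `L(n) v_t = (t + n) v_{n+t}`, `I(n) v_t = 0` for `t ≠ 0`, `I(n) v_0 = d n v_n`. -/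
def modV (d : ℂ) : Coeffs where
  l n t := t + n
  i n t := if t = 0 then d * n else 0
  hLL m n t := by push_cast; ring
  hLI m n t := by
    split_ifs <;> first
      | omega
      | (push_cast; ring1)
      | (have e := cast_rel m n t; push_cast; grind)
  hII m n t := by
    split_ifs <;> first
      | omega
      | (push_cast; ring1)
      | (have e := cast_rel m n t; push_cast; grind)

/-- `Ũ_d`: `L(n) v_t = t v_{n+t}` for `n + t ≠ 0`, `L(n) v_{-n} = 0`,
`I(n) v_t = 0` for `n + t ≠ 0`, `I(n) v_{-n} = d n v_0`. -/
def modUtilde (d : ℂ) : Coeffs where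
  l n t := if n + t = 0 then 0 else t
  i n t := if n + t = 0 then d * n else 0
  hLL m n t := by
    split_ifs <;> first
      | omega
      | (push_cast; ring1)
      | (have e := cast_rel m n t; push_cast; grind)
  hLI m n t := by
    split_ifs <;> first
      | omega
      | (push_cast; ring1)
      | (have e := cast_rel m n t; push_cast; grind)
  hII m n t := by
    split_ifs <;> first
      | omega
      | (push_cast; ring1)
      | (have e := cast_rel m n t; push_cast; grind)

/-- `Ṽ_c`: `L(n) v_t = t v_{n+t}` for `n + t ≠ 0`, `L(n) v_{-n} = 0`,
`I(n) v_t = 0` if `t ≠ 0` or `n = t = 0`, `I(n) v_0 = c v_n` for `n ≠ 0`. -/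
def modVtilde (c : ℂ) : Coeffs where
  l n t := if n + t = 0 then 0 else t
  i n t := if t ≠ 0 ∨ (n = 0 ∧ t = 0) then 0 else c
  hLL m n t := by
    split_ifs <;> first
      | omega
      | (push_cast; ring1)
      | (have e := cast_rel m n t; push_cast; grind)
  hLI m n t := by
    split_ifs <;> first
      | omega
      | (push_cast; ring1)
      | (have e := cast_rel m n t; push_cast; grind)
  hII m n t := by
    split_ifs <;> first
      | omega
      | (push_cast; ring1)
      | (have e := cast_rel m n t; push_cast; grind)

end TwistedHV

end

/-! Write L(y-x) v_x = K x y • v_y and I(y-x) v_x = J x y • v_y. Indecomposability makes the graph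
of nonzero structure constants connected, so C_L, C_I, C_LI, I(0) and L(0) minus the degree act by
scalars κ, mu, lam, c, a (`exists_rep`). What remains is to determine K and J up to rescaling the
v_x, and the quantities invariant under rescaling are the products along closed loops.

Loop products of L(±1), L(±2) are polynomials in the degree, by the bracket relations. The two
triangles with steps (2,-1,-1) and (1,1,-2) together use the same arrows as three loops of length
two, and this polynomial identity forces κ = 0 and leaves one parameter b (`exists_parameter`). In
large degrees no coefficient of L(±1) vanishes, so the basis can be scaled until the Virasoro part
is that of 𝒜_{a,b}. A similar identity for I(1) gives lam = 0 and J = c, if need be after replacing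
b = 0 by b = 1; then mu = 0 (`exists_rescale_isStandardFrom`).

The relations make the discrepancy between a loop product and its standard value periodic under
translation, and it vanishes in large degrees, so it vanishes everywhere (`mul_K_loop₃`,
`mul_J_loop₃`). Comparing each degree with a remote one then standardizes K and J
(`exists_rescale_eq`), except at a degree o with a + o = 0 when b is 0 or 1.

There is at most one such degree. If c ≠ 0, the I-action forces 𝒜_{a,b,c} there too. If c = 0, the
arrows into and out of o are described by a few parameters subject to orthogonality conditions, and
connectedness excludes that all vanish; the cases are the other six families
(`classified_of_I_zero`). -/

namespace TwistedHV

/-! ### Auxiliary facts on functions of an integer variable -/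

/-- This carries identities from large degrees to all degrees; D is the discrepancy between two loop
products. -/
theorem eq_zero_of_periodic {D : ℤ → ℂ} {p : ℤ} (hp : p ≠ 0) (h : ∀ t, D (t + p) = D t)
    {T : ℤ} (hT : ∀ t, T ≤ t → D t = 0) (t : ℤ) : D t = 0 := by
  have hper : Function.Periodic D p := h
  -- The total shift p² |T - t| goes upwards whatever the sign of p, and is at least T - t.
  have h1 := (hper.int_mul (p * |T - t|)) t
  rw [← h1]
  apply hT
  have h2 : 1 ≤ p * p := by
    have := mul_self_pos.mpr hp
    omega
  have h3 : T - t ≤ |T - t| := le_abs_self _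
  have h4 : 0 ≤ |T - t| := abs_nonneg _
  simp only [Int.cast_id]
  nlinarith

theorem eq_of_step {F : ℤ → ℂ} (h : ∀ t, F (t + 1) = F t) (t : ℤ) : F t = F 0 := by
  have hper : Function.Periodic F 1 := h
  have h1 := (hper.int_mul t) 0
  simpa using h1

theorem eventually_add_ne (z : ℂ) : ∃ T : ℤ, ∀ t, T ≤ t → z + t ≠ 0 := by
  obtain ⟨N, hN⟩ := exists_int_gt (-z.re)
  refine ⟨N, fun t ht h => ?_⟩
  have h1 := congrArg Complex.re h
  simp at h1
  have h2 : (N : ℝ) ≤ t := by exact_mod_cast ht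
  linarith

/-- Recurrences coming from L(±2) advance the degree by two, so identities are known only at the
points z + 2k. These are still infinitely many, more than a nonzero polynomial has roots. -/
theorem coeffs_eq_zero {c₀ c₁ c₂ c₃ c₄ c₅ z : ℂ}
    (h : ∀ k : ℕ, c₀ + c₁ * (z + 2 * k) + c₂ * (z + 2 * k) ^ 2 + c₃ * (z + 2 * k) ^ 3 +
      c₄ * (z + 2 * k) ^ 4 + c₅ * (z + 2 * k) ^ 5 = 0) :
    c₀ = 0 ∧ c₁ = 0 ∧ c₂ = 0 ∧ c₃ = 0 ∧ c₄ = 0 ∧ c₅ = 0 := by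
  open Polynomial in
  set p : ℂ[X] := C c₀ + C c₁ * X + C c₂ * X ^ 2 + C c₃ * X ^ 3 + C c₄ * X ^ 4 + C c₅ * X ^ 5
    with hp
  have hz : p = 0 := by
    apply Polynomial.eq_zero_of_infinite_isRoot
    refine (Set.infinite_range_of_injective (f := fun k : ℕ => z + 2 * (k : ℂ)) ?_).mono ?_
    · intro x y hxy
      simpa using hxy
    · rintro _ ⟨k, rfl⟩
      simp [hp, h k]
  have hc : ∀ j, p.coeff j = 0 := by simp [hz]
  have h0 := hc 0
  have h1 := hc 1
  have h2 := hc 2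
  have h3 := hc 3
  have h4 := hc 4
  have h5 := hc 5
  simp [hp, Polynomial.coeff_X, Polynomial.coeff_C, Polynomial.coeff_X_pow] at h0 h1 h2 h3 h4 h5
  exact ⟨h0, h1, h2, h3, h4, h5⟩

/-! ### Structure constants of a graded module with basis `v_x`, `x ∈ ℤ` -/

/-- Structure constants of a module over the twisted Heisenberg–Virasoro algebra with
`L(y - x) v_x = K x y • v_y`, `I(y - x) v_x = J x y • v_y`, on which `L(0) - x`, `C_L`, `C_LI`,
`C_I`, `I(0)` act on `v_x` by the scalars `a`, `κ`, `lam`, `mu`, `c`. -/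
structure Rep (K J : ℤ → ℤ → ℂ) (a κ lam mu c : ℂ) : Prop where
  diagK : ∀ x, K x x = a + x
  diagJ : ∀ x, J x x = c
  kk : ∀ x y y' z : ℤ, y + y' = x + z → K x y * K y z - K x y' * K y' z =
    ((y : ℂ) - y') * K x z + if x = z then (((y' : ℂ) - x) ^ 3 - (y' - x)) / 12 * κ else 0
  kj : ∀ x y y' z : ℤ, y + y' = x + z → J x y * K y z - K x y' * J y' z =
    ((y : ℂ) - x) * J x z + if x = z then (((y' : ℂ) - x) ^ 2 - (y' - x)) * lam else 0
  jj : ∀ x y y' z : ℤ, y + y' = x + z → J x y * J y z - J x y' * J y' z =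
    if x = z then ((y : ℂ) - x) * mu else 0

/-- The structure constants in the basis `g x • v_x`. -/
noncomputable def rescale (g : ℤ → ℂ) (K : ℤ → ℤ → ℂ) (x y : ℤ) : ℂ := K x y * g x / g y

/-- `(a + x) + b (y - x)`, the coefficient of `L(y - x) v_x` in `𝒜_{a,b,c}`. -/
noncomputable def lineCoeff (a b : ℂ) (x y : ℤ) : ℂ := a + x + b * ((y : ℂ) - x)

section Rescale

variable {K J : ℤ → ℤ → ℂ} {a κ lam mu c : ℂ} {g : ℤ → ℂ}

theorem rescale_mul (hg : ∀ x, g x ≠ 0) (A B : ℤ → ℤ → ℂ) (x y z : ℤ) :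
    rescale g A x y * rescale g B y z = A x y * B y z * (g x / g z) := by
  have := hg y
  have := hg z
  unfold rescale
  field_simp

theorem rescale_cycle₂ (hg : ∀ x, g x ≠ 0) (A B : ℤ → ℤ → ℂ) (x y : ℤ) :
    rescale g A x y * rescale g B y x = A x y * B y x := by
  rw [rescale_mul hg, div_self (hg x), mul_one]

theorem rescale_cycle₃ (hg : ∀ x, g x ≠ 0) (A B C : ℤ → ℤ → ℂ) (x y z : ℤ) :
    rescale g A x y * rescale g B y z * rescale g C z x = A x y * B y z * C z x := by
  have := hg x
  have := hg z
  rw [rescale_mul hg]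
  unfold rescale
  field_simp

theorem Rep.rescale (h : Rep K J a κ lam mu c) (hg : ∀ x, g x ≠ 0) :
    Rep (rescale g K) (rescale g J) a κ lam mu c where
  diagK x := by
    rw [TwistedHV.rescale, mul_div_assoc, div_self (hg x), mul_one, h.diagK]
  diagJ x := by
    rw [TwistedHV.rescale, mul_div_assoc, div_self (hg x), mul_one, h.diagJ]
  kk x y y' z e := by
    rw [rescale_mul hg, rescale_mul hg, ← sub_mul, h.kk x y y' z e, TwistedHV.rescale]
    split_ifs with hxz
    · subst hxz
      rw [div_self (hg x), mul_div_assoc, div_self (hg x)]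
      ring
    · ring
  kj x y y' z e := by
    rw [rescale_mul hg, rescale_mul hg, ← sub_mul, h.kj x y y' z e, TwistedHV.rescale]
    split_ifs with hxz
    · subst hxz
      rw [div_self (hg x), mul_div_assoc, div_self (hg x)]
      ring
    · ring
  jj x y y' z e := by
    rw [rescale_mul hg, rescale_mul hg, ← sub_mul, h.jj x y y' z e]
    split_ifs with hxz
    · subst hxz
      rw [div_self (hg x), mul_one]
    · ring

end Rescale

namespace Rep

variable {K J : ℤ → ℤ → ℂ} {a κ lam mu c : ℂ}

theorem kk_of_ne (h : Rep K J a κ lam mu c) {x y y' z : ℤ} (e : y + y' = x + z) (hne : x ≠ z) :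
    K x y * K y z - K x y' * K y' z = ((y : ℂ) - y') * K x z := by
  rw [h.kk x y y' z e, if_neg hne, add_zero]

theorem kj_of_ne (h : Rep K J a κ lam mu c) {x y y' z : ℤ} (e : y + y' = x + z) (hne : x ≠ z) :
    J x y * K y z - K x y' * J y' z = ((y : ℂ) - x) * J x z := by
  rw [h.kj x y y' z e, if_neg hne, add_zero]

theorem jj_of_ne (h : Rep K J a κ lam mu c) {x y y' z : ℤ} (e : y + y' = x + z) (hne : x ≠ z) :
    J x y * J y z = J x y' * J y' z := by
  have := h.jj x y y' z e
  rw [if_neg hne] at this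
  linear_combination this

theorem kk_loop (h : Rep K J a κ lam mu c) {x y y' : ℤ} (e : y + y' = x + x) :
    K x y * K y x - K x y' * K y' x = ((y : ℂ) - y') * (a + x) +
      (((y' : ℂ) - x) ^ 3 - (y' - x)) / 12 * κ := by
  rw [h.kk x y y' x e, if_pos rfl, h.diagK]

theorem kj_loop (h : Rep K J a κ lam mu c) {x y y' : ℤ} (e : y + y' = x + x) :
    J x y * K y x - K x y' * J y' x = ((y : ℂ) - x) * c +
      (((y' : ℂ) - x) ^ 2 - (y' - x)) * lam := by
  rw [h.kj x y y' x e, if_pos rfl, h.diagJ]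

/-- The products of structure constants of the Virasoro part along the loops of length one and
two, and the vanishing of the central charge. -/
theorem exists_parameter (h : Rep K J a κ lam mu c) : κ = 0 ∧ ∃ b : ℂ, b ≠ 1 ∧
    (∀ t : ℤ, K t (t + 1) * K (t + 1) t = (a + t + b) * (a + t + 1 - b)) ∧
    (∀ t : ℤ, K t (t + 2) * K (t + 2) (t + 1) * K (t + 1) t =
      (a + t + 2 * b) * (a + t + 2 - b) * (a + t + 1 - b)) ∧
    (∀ t : ℤ, K t (t + 1) * K (t + 1) (t + 2) * K (t + 2) t =
      (a + t + b) * (a + t + 1 + b) * (a + t + 2 - 2 * b)) := by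
  -- The cocycle (m³ - m)/12 vanishes at m = ±1, so consecutive loop products differ by 2(a + t + 1)
  -- without any κ.
  obtain ⟨β, hβ⟩ : ∃ β : ℂ, ∀ t : ℤ, K t (t + 1) * K (t + 1) t =
      (a + t) ^ 2 + (a + t) + β := by
    refine ⟨K 0 1 * K 1 0 - a ^ 2 - a, fun t => ?_⟩
    have := eq_of_step (F := fun t : ℤ => K t (t + 1) * K (t + 1) t - ((a + t) ^ 2 + (a + t)))
      (fun t => by
        have := h.kk_loop (x := t + 1) (y := t + 1 + 1) (y' := t) (by ring)
        push_cast at this ⊢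
        linear_combination this) t
    simp at this
    linear_combination this
  obtain ⟨p, hp⟩ : ∃ p : ℂ, ∀ t : ℤ, K t (t + 2) * K (t + 2) (t + 1) * K (t + 1) t =
      (a + t + 1) ^ 3 + (3 * β - 1) * (a + t + 1) + p := by
    refine ⟨K 0 2 * K 2 1 * K 1 0 - ((a + 1) ^ 3 + (3 * β - 1) * (a + 1)), fun t => ?_⟩
    have := eq_of_step (F := fun t : ℤ => K t (t + 2) * K (t + 2) (t + 1) * K (t + 1) t -
      ((a + t + 1) ^ 3 + (3 * β - 1) * (a + t + 1)))
      (fun t => by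
        -- This is [L(-1), L(2)] = 3 L(1), closed up to a loop by L(-1).
        have e1 := h.kk_of_ne (x := t + 1) (y := t + 3) (y' := t) (z := t + 2) (by ring) (by omega)
        have e2 := hβ (t + 1)
        rw [show t + 1 + 1 = t + 2 by ring] at e2
        simp only [show t + 1 + 1 = t + 2 by ring, show t + 1 + 2 = t + 3 by ring]
        push_cast at e1 e2 ⊢
        linear_combination e1 * K (t + 2) (t + 1) + 3 * e2) t
    simp at this
    linear_combination this
  obtain ⟨q, hq⟩ : ∃ q : ℂ, ∀ t : ℤ, K t (t + 1) * K (t + 1) (t + 2) * K (t + 2) t =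
      (a + t + 1) ^ 3 + (3 * β - 1) * (a + t + 1) + q := by
    refine ⟨K 0 1 * K 1 2 * K 2 0 - ((a + 1) ^ 3 + (3 * β - 1) * (a + 1)), fun t => ?_⟩
    have := eq_of_step (F := fun t : ℤ => K t (t + 1) * K (t + 1) (t + 2) * K (t + 2) t -
      ((a + t + 1) ^ 3 + (3 * β - 1) * (a + t + 1)))
      (fun t => by
        have e1 := h.kk_of_ne (x := t + 2) (y := t + 3) (y' := t) (z := t + 1) (by ring) (by omega)
        have e2 := hβ (t + 1)
        rw [show t + 1 + 1 = t + 2 by ring] at e2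
        simp only [show t + 1 + 1 = t + 2 by ring, show t + 1 + 2 = t + 3 by ring]
        push_cast at e1 e2 ⊢
        linear_combination e1 * K (t + 1) (t + 2) + 3 * e2) t
    simp at this
    linear_combination this
  obtain ⟨r, hr⟩ : ∃ r : ℂ, ∀ k : ℕ, K (2 * k) (2 * k + 2) * K (2 * k + 2) (2 * k) =
      (a + 1 + 2 * k) ^ 2 - κ / 4 * (a + 1 + 2 * k) + r := by
    refine ⟨K 0 2 * K 2 0 - ((a + 1) ^ 2 - κ / 4 * (a + 1)), fun k => ?_⟩
    induction k with
    | zero => simp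
    | succ k ih =>
      have e1 := h.kk_loop (x := 2 * k + 2) (y := 2 * k + 4) (y' := 2 * k) (by ring)
      push_cast at e1 ih ⊢
      rw [show (2 : ℤ) * (k + 1) = 2 * k + 2 by ring, show (2 : ℤ) * k + 2 + 2 = 2 * k + 4 by ring]
      linear_combination e1 + ih
  -- The product of the two triangles on t, t+1, t+2 equals the product of the three loops of length
  -- two on their edges. Both sides are monic of degree 6 in s = a + 1 + 2k, so the difference has
  -- degree at most 5.
  have key := coeffs_eq_zero (z := a + 1) (c₀ := p * q - r * β ^ 2)
    (c₁ := (3 * β - 1) * (p + q) + κ / 4 * β ^ 2)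
    (c₂ := (3 * β - 1) ^ 2 - β ^ 2 - r * (2 * β - 1))
    (c₃ := p + q + κ / 4 * (2 * β - 1)) (c₄ := 2 * (3 * β - 1) - (2 * β - 1) - r)
    (c₅ := κ / 4) (fun k => by
      have e1 := hp (2 * k)
      have e2 := hq (2 * k)
      have e3 := hr k
      have e4 := hβ (2 * k)
      have e5 := hβ (2 * k + 1)
      rw [show (2 : ℤ) * k + 1 + 1 = 2 * k + 2 by ring] at e5
      push_cast at e1 e2 e3 e4 e5
      have e6 := congrArg₂ (· * ·) e1 e2
      have e7 := congrArg₂ (· * ·) e3 (congrArg₂ (· * ·) e4 e5)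
      linear_combination e7 - e6)
  obtain ⟨k0, -, -, k3, k4, k5⟩ := key
  have hκ : κ = 0 := by linear_combination 4 * k5
  subst hκ
  have hq' : q = -p := by linear_combination k3
  have hr' : r = 4 * β - 1 := by linear_combination -k4
  subst hq' hr'
  -- The constant term says p² = β²(1 - 4β), and b solves 1 - 2b = p/β. When β = 0 also p = 0; then
  -- b = 0 and b = 1 give the same loop products, and b = 0 is taken.
  obtain ⟨b, hb1, hb, hb'⟩ : ∃ b : ℂ, b ≠ 1 ∧ β = b * (1 - b) ∧ p = β * (1 - 2 * b) := by
    by_cases h0 : β = 0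
    · subst h0
      exact ⟨0, by simp, by simp, by simpa using k0⟩
    · have e : β = (1 - p / β) / 2 * (1 - (1 - p / β) / 2) := by
        field_simp
        linear_combination -k0
      refine ⟨(1 - p / β) / 2, fun hh => h0 ?_, e, by field_simp; ring⟩
      rw [e, hh]
      ring
  subst hb'
  refine ⟨rfl, b, hb1, fun t => ?_, fun t => ?_, fun t => ?_⟩
  · rw [hβ, hb]; ring
  · rw [hp, hb]; ring
  · rw [hq, hb]; ring

end Rep
end TwistedHV

/-! ### Normal form of L(n) and I(1) in large degrees -/

namespace TwistedHV
namespace Rep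

variable {K J : ℤ → ℤ → ℂ} {a κ lam mu c : ℂ}

/-- A rescaling which normalizes the action of `L(1)` on the part of large degree. -/
theorem exists_rescale_step {b : ℂ} {T : ℤ}
    (hK : ∀ t, T ≤ t → K t (t + 1) ≠ 0) (hb : ∀ t : ℤ, T ≤ t → a + b + t ≠ 0) :
    ∃ g : ℤ → ℂ, (∀ x, g x ≠ 0) ∧
      ∀ t : ℤ, T ≤ t → TwistedHV.rescale g K t (t + 1) = a + t + b := by
  set G : ℕ → ℂ := fun n => ∏ j ∈ Finset.range n, (K (T + j) (T + j + 1) / (a + b + (T + j : ℤ)))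
    with hG
  have hGne : ∀ n, G n ≠ 0 := fun n => Finset.prod_ne_zero_iff.mpr fun j _ =>
    div_ne_zero (hK _ (by omega)) (hb _ (by omega))
  -- Below T the truncation `toNat` gives the empty product, so those basis vectors are unchanged.
  refine ⟨fun t => G (t - T).toNat, fun x => hGne _, fun t ht => ?_⟩
  obtain ⟨n, rfl⟩ := Int.le.dest ht
  have e1 : (T + n - T).toNat = n := by omega
  have e2 : (T + n + 1 - T).toNat = n + 1 := by omega
  have e3 : G (n + 1) = G n * (K (T + n) (T + n + 1) / (a + b + (T + n : ℤ))) :=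
    Finset.prod_range_succ _ _
  have h1 := hGne n
  have h2 := hK (T + n) ht
  have h3 := hb (T + n) ht
  simp only [TwistedHV.rescale, e1, e2, e3]
  field_simp
  ring

/-- On the part of large degree, the Virasoro part is determined by the action of `L(1)`. -/
theorem eq_lineCoeff_of_step (h : Rep K J a 0 lam mu c) {b : ℂ} {T : ℤ}
    (hb : ∀ t : ℤ, T ≤ t → a + b + t ≠ 0) (hb' : ∀ t : ℤ, T ≤ t → a + 1 - b + t ≠ 0)
    (h1 : ∀ t : ℤ, K t (t + 1) * K (t + 1) t = (a + t + b) * (a + t + 1 - b))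
    (h2 : ∀ t : ℤ, K t (t + 2) * K (t + 2) (t + 1) * K (t + 1) t =
      (a + t + 2 * b) * (a + t + 2 - b) * (a + t + 1 - b))
    (h3 : ∀ t : ℤ, K t (t + 1) * K (t + 1) (t + 2) * K (t + 2) t =
      (a + t + b) * (a + t + 1 + b) * (a + t + 2 - 2 * b))
    (hs : ∀ t : ℤ, T ≤ t → K t (t + 1) = a + t + b) {x y : ℤ} (hx : T ≤ x) (hy : T ≤ y) :
    K x y = lineCoeff a b x y := by
  have d1 : ∀ t : ℤ, T ≤ t → K (t + 1) t = a + t + 1 - b := fun t ht => by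
    have e := h1 t
    rw [hs t ht] at e
    refine mul_left_cancel₀ (hb t ht) ?_
    linear_combination e
  have u2 : ∀ t : ℤ, T ≤ t → K t (t + 2) = a + t + 2 * b := fun t ht => by
    have e := h2 t
    have e' := d1 (t + 1) (by omega)
    rw [show t + 1 + 1 = t + 2 by ring] at e'
    rw [d1 t ht, e'] at e
    refine mul_right_cancel₀ (mul_ne_zero (hb' (t + 1) (by omega)) (hb' t ht)) ?_
    push_cast at e ⊢
    linear_combination e
  have d2 : ∀ t : ℤ, T ≤ t → K (t + 2) t = a + t + 2 - 2 * b := fun t ht => by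
    have e := h3 t
    have e' := hs (t + 1) (by omega)
    rw [show t + 1 + 1 = t + 2 by ring] at e'
    rw [hs t ht, e'] at e
    refine mul_left_cancel₀ (mul_ne_zero (hb t ht) (hb (t + 1) (by omega))) ?_
    push_cast at e ⊢
    linear_combination e
  -- The induction uses [L(1), L(n)] = (n - 1) L(n + 1). The factor n - 1 vanishes at n = 1, so
  -- L(±2) had to be found separately.
  have up : ∀ n : ℕ, 2 ≤ n → ∀ t : ℤ, T ≤ t →
      K t (t + n) = a + t + b * n ∧ K (t + n) t = a + t + n - b * n := by
    intro n hn
    induction n, hn using Nat.le_induction with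
    | base =>
      intro t ht
      refine ⟨(u2 t ht).trans ?_, (d2 t ht).trans ?_⟩ <;> push_cast <;> ring
    | succ n hn ih =>
      intro t ht
      have hn' : (n : ℂ) - 1 ≠ 0 := by
        rw [sub_ne_zero]
        exact_mod_cast (show n ≠ 1 by omega)
      have e1 := h.kk_of_ne (x := t) (y := t + n) (y' := t + 1) (z := t + n + 1)
        (by ring) (by omega)
      have e2 := h.kk_of_ne (x := t + n + 1) (y := t + n) (y' := t + 1) (z := t)
        (by ring) (by omega)
      have i1 := ih t ht
      have i2 := ih (t + 1) (by omega)
      have s1 := hs (t + n) (by omega)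
      have s2 := d1 (t + n) (by omega)
      rw [show t + 1 + (n : ℤ) = t + n + 1 by ring] at i2
      rw [i1.1, i2.1, hs t ht, s1] at e1
      rw [i1.2, i2.2, d1 t ht, s2] at e2
      push_cast at e1 e2 ⊢
      rw [← add_assoc]
      constructor
      · refine mul_left_cancel₀ hn' ?_
        linear_combination -e1
      · refine mul_left_cancel₀ hn' ?_
        linear_combination -e2
  have up' : ∀ n : ℕ, ∀ t : ℤ, T ≤ t →
      K t (t + n) = a + t + b * n ∧ K (t + n) t = a + t + n - b * n := by
    intro n t ht
    rcases Nat.lt_or_ge n 2 with hn | hn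
    · interval_cases n
      · simp [h.diagK]
      · simp [hs t ht, d1 t ht]
    · exact up n hn t ht
  unfold lineCoeff
  rcases le_total x y with hxy | hxy
  · obtain ⟨n, rfl⟩ := Int.le.dest hxy
    rw [(up' n x hx).1]
    push_cast
    ring
  · obtain ⟨n, rfl⟩ := Int.le.dest hxy
    rw [(up' n y hy).2]
    push_cast
    ring

/-- After a rescaling, the Virasoro part has the standard form on the part of large degree. -/
theorem exists_rescale_lineCoeff (h : Rep K J a κ lam mu c) : κ = 0 ∧ ∃ b : ℂ, b ≠ 1 ∧
    ∃ g : ℤ → ℂ, (∀ x, g x ≠ 0) ∧ ∃ T : ℤ, ∀ x y, T ≤ x → T ≤ y →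
      TwistedHV.rescale g K x y = lineCoeff a b x y := by
  obtain ⟨rfl, b, hb1, h1, h2, h3⟩ := h.exists_parameter
  obtain ⟨T₁, hT₁⟩ := eventually_add_ne (a + b)
  obtain ⟨T₂, hT₂⟩ := eventually_add_ne (a + 1 - b)
  obtain ⟨g, hg, hs⟩ := exists_rescale_step (K := K) (a := a) (b := b) (T := max T₁ T₂)
    (fun t ht h0 => by
      have e := h1 t
      rw [h0, zero_mul] at e
      refine mul_ne_zero (hT₁ t (by omega)) (hT₂ t (by omega)) ?_
      linear_combination -e) (fun t ht => hT₁ t (by omega))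
  refine ⟨rfl, b, hb1, g, hg, max T₁ T₂, fun x y hx hy => ?_⟩
  refine (h.rescale hg).eq_lineCoeff_of_step (fun t ht => hT₁ t (by omega))
    (fun t ht => hT₂ t (by omega)) ?_ ?_ ?_ hs hx hy
  · intro t
    rw [rescale_cycle₂ hg, h1]
  · intro t
    rw [rescale_cycle₃ hg, h2]
  · intro t
    rw [rescale_cycle₃ hg, h3]

/-- The action of `I(1)` on the part of large degree. -/
theorem exists_I_one (h : Rep K J a 0 lam mu c) {b : ℂ} {T : ℤ} (hb : b ≠ 1)
    (hK : ∀ x y, T ≤ x → T ≤ y → K x y = lineCoeff a b x y) :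
    lam = 0 ∧ ∃ r : ℂ, r * b = 0 ∧
      ∀ t : ℤ, T ≤ t → (J t (t + 1) - c) * (a + t + 1 - b) = r := by
  obtain ⟨B, hB⟩ : ∃ B : ℂ, ∀ t : ℤ, J t (t + 1) * K (t + 1) t = (c + 2 * lam) * t + B := by
    refine ⟨J 0 1 * K 1 0, fun t => ?_⟩
    have := eq_of_step (F := fun t : ℤ => J t (t + 1) * K (t + 1) t - (c + 2 * lam) * t)
      (fun t => by
        have := h.kj_loop (x := t + 1) (y := t + 1 + 1) (y' := t) (by ring)
        push_cast at this ⊢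
        linear_combination this) t
    simp at this
    linear_combination this
  obtain ⟨B', hB'⟩ : ∃ B' : ℂ, ∀ k : ℕ, J (T + 2 * k) (T + 2 * k + 2) *
      K (T + 2 * k + 2) (T + 2 * k) = (c + 3 * lam) * (a + T + 2 * k) + B' := by
    refine ⟨J T (T + 2) * K (T + 2) T - (c + 3 * lam) * (a + T), fun k => ?_⟩
    induction k with
    | zero => simp
    | succ k ih =>
      have e1 := h.kj_loop (x := T + 2 * k + 2) (y := T + 2 * k + 4) (y' := T + 2 * k) (by ring)
      push_cast at e1 ih ⊢
      rw [show T + (2 : ℤ) * (k + 1) = T + 2 * k + 2 by ring,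
        show T + (2 : ℤ) * k + 2 + 2 = T + 2 * k + 4 by ring]
      linear_combination e1 + ih
  set r : ℂ := B - (c + 2 * lam) * (a + 1 - b) with hr
  -- The relation [L(1), I(1)] = I(2) is multiplied by the coefficients of the downward arrows t+1 →
  -- t, t+2 → t+1 and t+2 → t. This turns each J into a loop product, known to be affine, and leaves
  -- a polynomial identity in s = a + T + 2k.
  have key := coeffs_eq_zero (z := a + T)
    (c₀ := ((c + 2 * lam) * (2 - 2 * b) - B') * ((1 - b) * (2 - b)) + 2 * r * (2 - 2 * b))
    (c₁ := -lam * ((1 - b) * (2 - b)) + ((c + 2 * lam) * (2 - 2 * b) - B') * (3 - 2 * b) +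
      2 * r * (3 - 2 * b))
    (c₂ := -lam * (3 - 2 * b) + ((c + 2 * lam) * (2 - 2 * b) - B') + 2 * r)
    (c₃ := -lam) (c₄ := 0) (c₅ := 0) (fun k => by
      have e1 := hB (T + 2 * k)
      have e2 := hB (T + 2 * k + 1)
      have e3 := hB' k
      have e4 := h.kj_of_ne (x := T + 2 * k) (y := T + 2 * k + 1) (y' := T + 2 * k + 1)
        (z := T + 2 * k + 2) (by ring) (by omega)
      rw [show T + (2 : ℤ) * k + 1 + 1 = T + 2 * k + 2 by ring] at e2
      rw [hK _ _ (by omega) (by omega)] at e1 e2 e3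
      rw [hK _ _ (by omega) (by omega), hK _ _ (by omega) (by omega)] at e4
      unfold lineCoeff at e1 e2 e3 e4
      push_cast at e1 e2 e3 e4
      obtain ⟨s, hs⟩ : ∃ s : ℂ, s = a + T + 2 * k := ⟨_, rfl⟩
      rw [← hs, hr]
      have hT : (T : ℂ) = s - a - 2 * k := by rw [hs]; ring
      rw [hT] at e1 e2 e3 e4
      linear_combination (-((s + 2 - b) * (s + 1 + b) * (s + 2 - 2 * b))) * e1 +
        ((s + b) * (s + 1 - b) * (s + 2 - 2 * b)) * e2 +
        ((s + 1 - b) * (s + 2 - b) * (s + 2 - 2 * b)) * e4 + ((s + 1 - b) * (s + 2 - b)) * e3)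
  obtain ⟨k0, -, k2, k3, -, -⟩ := key
  have hl : lam = 0 := by linear_combination -k3
  refine ⟨hl, r, ?_, fun t ht => ?_⟩
  · subst hl
    have e : r * b * (1 - b) = 0 := by
      linear_combination (k0 - k2 * ((1 - b) * (2 - b))) / 2
    exact (mul_eq_zero.mp e).resolve_right (sub_ne_zero.mpr hb.symm)
  · subst hl
    have e1 := hB t
    rw [hK _ _ (by omega) (by omega)] at e1
    unfold lineCoeff at e1
    push_cast at e1
    rw [hr]
    linear_combination e1

end Rep
end TwistedHV

/-! ### Standard form of both actions in large degrees -/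

namespace TwistedHV

theorem rescale_rescale (g g' : ℤ → ℂ) (K : ℤ → ℤ → ℂ) :
    rescale g' (rescale g K) = rescale (fun x => g x * g' x) K := by
  funext x y
  simp only [rescale, div_eq_mul_inv, mul_inv]
  ring

/-- The structure constants agree with those of `𝒜_{a,b,c}` in degrees at least `T`. -/
structure IsStandardFrom (T : ℤ) (K J : ℤ → ℤ → ℂ) (a b c : ℂ) : Prop where
  K_eq : ∀ x y, T ≤ x → T ≤ y → K x y = lineCoeff a b x y
  J_eq : ∀ x y, T ≤ x → T ≤ y → J x y = c

namespace Rep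

variable {K J : ℤ → ℤ → ℂ} {a κ lam mu c : ℂ}

/-- The relation [L(n-1), I(1)] = I(n) recovers every I(n) from I(1). It passes through degree y -
1, hence the bound T + 1. -/
theorem isStandardFrom_of_I_one (h : Rep K J a κ lam mu c) {b : ℂ} {T : ℤ}
    (hK : ∀ x y, T ≤ x → T ≤ y → K x y = lineCoeff a b x y)
    (hJ : ∀ t : ℤ, T ≤ t → J t (t + 1) = c) : IsStandardFrom (T + 1) K J a b c where
  K_eq x y hx hy := hK x y (by omega) (by omega)
  J_eq x y hx hy := by
    rcases eq_or_ne x y with rfl | hne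
    · exact h.diagJ x
    · have e := h.kj_of_ne (x := x) (y := x + 1) (y' := y - 1) (z := y) (by ring) hne
      have e' := hJ (y - 1) (by omega)
      rw [sub_add_cancel] at e'
      rw [hJ x (by omega), e', hK _ _ (by omega) (by omega), hK _ _ (by omega) (by omega)] at e
      unfold lineCoeff at e
      push_cast at e
      linear_combination -e

theorem exists_rescale_isStandardFrom (h : Rep K J a κ lam mu c) :
    κ = 0 ∧ lam = 0 ∧ mu = 0 ∧ ∃ (b : ℂ) (g : ℤ → ℂ), (∀ x, g x ≠ 0) ∧
      ∃ T, IsStandardFrom T (TwistedHV.rescale g K) (TwistedHV.rescale g J) a b c := by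
  obtain ⟨rfl, b, hb1, g, hg, T, hT⟩ := h.exists_rescale_lineCoeff
  have h' := h.rescale hg
  obtain ⟨rfl, r, hrb, hr⟩ := h'.exists_I_one hb1 hT
  have fin : ∃ (b : ℂ) (g : ℤ → ℂ), (∀ x, g x ≠ 0) ∧
      ∃ T, IsStandardFrom T (TwistedHV.rescale g K) (TwistedHV.rescale g J) a b c := by
    rcases eq_or_ne r 0 with rfl | hr0
    · obtain ⟨T', hT'⟩ := eventually_add_ne (a + 1 - b)
      refine ⟨b, g, hg, max T T' + 1, h'.isStandardFrom_of_I_one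
        (fun x y hx hy => hT x y (by omega) (by omega)) fun t ht => ?_⟩
      have e1 := hr t (by omega)
      have e2 : a + t + 1 - b ≠ 0 := fun h0 => hT' t (by omega) (by linear_combination h0)
      linear_combination (mul_eq_zero.mp e1).resolve_right e2
    · obtain rfl : b = 0 := (mul_eq_zero.mp hrb).resolve_left hr0
      obtain ⟨T', hT'⟩ := eventually_add_ne a
      set S := max T T' with hS
      set J' := TwistedHV.rescale g J with hJ'
      have J1 : ∀ t : ℤ, S ≤ t → J' t (t + 1) = c + r / (a + (t + 1 : ℤ)) := fun t ht => by
        have e1 := hr t (by omega)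
        have e2 := hT' (t + 1) (by omega)
        field_simp
        push_cast
        linear_combination e1
      have J2 : ∀ t : ℤ, S ≤ t → J' t (t + 2) = c + 2 * r / (a + (t + 2 : ℤ)) := fun t ht => by
        have e1 := h'.kj_of_ne (x := t) (y := t + 1) (y' := t + 1) (z := t + 2) (by ring) (by omega)
        have e2 := hT' (t + 1) (by omega)
        have e3 := hT' (t + 2) (by omega)
        have e4 := J1 (t + 1) (by omega)
        rw [show t + 1 + 1 = t + 2 by ring] at e4
        rw [J1 t ht, e4, hT _ _ (by omega) (by omega), hT _ _ (by omega) (by omega)] at e1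
        unfold lineCoeff at e1
        push_cast at e1 e2 e3 ⊢
        field_simp at e1 ⊢
        refine mul_left_cancel₀ e2 ?_
        linear_combination -e1
      -- I(1) and I(2) commute; comparing both orders from S to S + 3 gives r (r + c) = 0.
      have hrc : r = -c := by
        have e1 := h'.jj_of_ne (x := S) (y := S + 1) (y' := S + 2) (z := S + 3)
          (by ring) (by omega)
        have e2 := hT' (S + 1) (by omega)
        have e3 := hT' (S + 2) (by omega)
        have e4 := hT' (S + 3) (by omega)
        have e5 := J1 (S + 2) (by omega)
        have e6 := J2 (S + 1) (by omega)
        rw [show S + 2 + 1 = S + 3 by ring] at e5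
        rw [show S + 1 + 2 = S + 3 by ring] at e6
        rw [J1 S le_rfl, J2 S le_rfl, e5, e6] at e1
        push_cast at e1 e2 e3 e4
        field_simp at e1
        have e7 : r * (r + c) = 0 := by
          linear_combination e1 / 2
        linear_combination (mul_eq_zero.mp e7).resolve_left hr0
      subst hrc
      -- Here I(1) has coefficient c (a + t)/(a + t + 1). Dividing v_t by a + t makes it c and turns
      -- the Virasoro part with b = 0 into that with b = 1.
      set g' : ℤ → ℂ := fun t => if S ≤ t then (a + t)⁻¹ else 1 with hg'
      have hg'0 : ∀ x, g' x ≠ 0 := fun x => by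
        simp only [hg']
        split_ifs with hx
        · exact inv_ne_zero (hT' x (by omega))
        · exact one_ne_zero
      refine ⟨1, fun x => g x * g' x, fun x => mul_ne_zero (hg x) (hg'0 x), S + 1, ?_⟩
      rw [← rescale_rescale, ← rescale_rescale]
      refine (h'.rescale hg'0).isStandardFrom_of_I_one (fun x y hx hy => ?_) fun t ht => ?_
      · have e1 := hT' x (by omega)
        have e2 := hT' y (by omega)
        rw [TwistedHV.rescale, hT x y (by omega) (by omega)]
        simp only [hg', if_pos hx, if_pos hy, lineCoeff]
        field_simp
        ring
      · have e1 := hT' t (by omega)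
        have e2 := hT' (t + 1) (by omega)
        rw [TwistedHV.rescale, J1 t ht]
        simp only [hg', if_pos ht, if_pos (show S ≤ t + 1 by omega)]
        push_cast at e2 ⊢
        field_simp
        ring
  refine ⟨rfl, rfl, ?_, fin⟩
  obtain ⟨b, g, hg, T, hs⟩ := fin
  have e := (h.rescale hg).jj (T + 1) (T + 2) T (T + 1) (by ring)
  rw [hs.J_eq _ _ (by omega) (by omega), hs.J_eq _ _ (by omega) (by omega),
    hs.J_eq _ _ (by omega) (by omega), hs.J_eq _ _ (by omega) (by omega), if_pos rfl] at e
  push_cast at e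
  linear_combination -e

/-! ### Products of structure constants along loops -/

section Loops

variable {b : ℂ} {T : ℤ}

/-- The bracket [L(n), L(-n)] at one vertex compares two adjacent loops of step n. The standard
constants satisfy the same relation, so the discrepancy has period n. -/
theorem mul_K_loop₂ (h : Rep K J a 0 0 0 c) (hs : IsStandardFrom T K J a b c) (x y : ℤ) :
    K x y * K y x = lineCoeff a b x y * lineCoeff a b y x := by
  obtain ⟨n, rfl⟩ : ∃ n, y = x + n := ⟨y - x, by ring⟩
  rcases eq_or_ne n 0 with rfl | hn
  · simp [h.diagK, lineCoeff]
  · have := eq_zero_of_periodic (D := fun t => K t (t + n) * K (t + n) t -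
      lineCoeff a b t (t + n) * lineCoeff a b (t + n) t) hn (T := T + |n|) (fun t => by
        have e := h.kk_loop (x := t + n) (y := t + n + n) (y' := t) (by ring)
        unfold lineCoeff
        push_cast at e ⊢
        linear_combination e) (fun t ht => by
        have := neg_abs_le n
        have := abs_nonneg n
        rw [hs.K_eq _ _ (by omega) (by omega), hs.K_eq _ _ (by omega) (by omega), sub_self]) x
    exact sub_eq_zero.mp this

theorem mul_J_loop₂ (h : Rep K J a 0 0 0 c) (hs : IsStandardFrom T K J a b c) (x y : ℤ) :
    J x y * K y x = c * lineCoeff a b y x := by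
  obtain ⟨n, rfl⟩ : ∃ n, y = x + n := ⟨y - x, by ring⟩
  rcases eq_or_ne n 0 with rfl | hn
  · simp [h.diagK, h.diagJ, lineCoeff]
  · have := eq_zero_of_periodic (D := fun t => J t (t + n) * K (t + n) t -
      c * lineCoeff a b (t + n) t) hn (T := T + |n|) (fun t => by
        have e := h.kj_loop (x := t + n) (y := t + n + n) (y' := t) (by ring)
        unfold lineCoeff
        push_cast at e ⊢
        linear_combination e) (fun t ht => by
        have := neg_abs_le n
        have := abs_nonneg n
        rw [hs.K_eq _ _ (by omega) (by omega), hs.J_eq _ _ (by omega) (by omega), sub_self]) x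
    exact sub_eq_zero.mp this

/-- A bracket relation reflects one vertex of a triangle through the midpoint of the other two, at
the cost of a loop of length two, which is already known. Two such reflections amount to a
translation of the triangle, so the discrepancy is periodic. -/
theorem mul_K_loop₃ (h : Rep K J a 0 0 0 c) (hs : IsStandardFrom T K J a b c) (x y z : ℤ) :
    K x y * K y z * K z x = lineCoeff a b x y * lineCoeff a b y z * lineCoeff a b z x := by
  have diag : ∀ x, K x x = lineCoeff a b x x := fun x => by simp [h.diagK, lineCoeff]
  rcases eq_or_ne x z with rfl | hxz
  · rw [h.mul_K_loop₂ hs, diag]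
  rcases eq_or_ne y z with rfl | hyz
  · rw [diag, mul_right_comm, h.mul_K_loop₂ hs, mul_right_comm]
  rcases eq_or_ne x y with rfl | hxy
  · rw [diag, mul_assoc, h.mul_K_loop₂ hs, mul_assoc]
  set D : ℤ → ℤ → ℤ → ℂ := fun x y z => K x y * K y z * K z x -
    lineCoeff a b x y * lineCoeff a b y z * lineCoeff a b z x with hD
  have cyc : ∀ x y z, D x y z = D y z x := fun x y z => by
    simp only [hD]
    ring
  have swap : ∀ x y y' z : ℤ, y + y' = x + z → x ≠ z → D x y z = D x y' z := by
    intro x y y' z e hne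
    have e1 := h.kk_of_ne e hne
    have e2 := h.mul_K_loop₂ hs x z
    obtain rfl : y' = x + z - y := by omega
    simp only [hD]
    unfold lineCoeff at e2 ⊢
    push_cast at e1 ⊢
    linear_combination e1 * K z x + ((y : ℂ) - (x + z - y)) * e2
  have step : ∀ x y z : ℤ, x ≠ z → y ≠ z →
      D x y z = D (x + (x - y)) (y + (x - y)) (z + (x - y)) := by
    intro x y z h1 h2
    rw [swap x y (x + z - y) z (by ring) h1, cyc x,
      swap (x + z - y) z (2 * x - y) x (by ring) (by omega), cyc (x + z - y)]
    congr 1 <;> ring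
  have := eq_zero_of_periodic (D := fun t => D (x + t) (y + t) (z + t)) (p := x - y)
    (sub_ne_zero.mpr hxy) (T := T + |x| + |y| + |z|) (fun t => by
      rw [step (x + t) (y + t) (z + t) (by omega) (by omega)]
      congr 1 <;> ring) (fun t ht => by
      have := neg_abs_le x
      have := neg_abs_le y
      have := neg_abs_le z
      have := abs_nonneg x
      have := abs_nonneg y
      have := abs_nonneg z
      simp only [hD]
      rw [hs.K_eq _ _ (by omega) (by omega), hs.K_eq _ _ (by omega) (by omega),
        hs.K_eq _ _ (by omega) (by omega), sub_self]) 0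
  simp only [add_zero] at this
  exact sub_eq_zero.mp this

/-- Again two reflections translate the triangle. One comes from an L–I bracket and moves the
I-arrow to another edge; the other comes from an L–L bracket and keeps it in place. -/
theorem mul_J_loop₃ (h : Rep K J a 0 0 0 c) (hs : IsStandardFrom T K J a b c) (x y z : ℤ) :
    J x y * K y z * K z x = c * lineCoeff a b y z * lineCoeff a b z x := by
  have diag : ∀ x, K x x = lineCoeff a b x x := fun x => by simp [h.diagK, lineCoeff]
  rcases eq_or_ne x z with rfl | hxz
  · rw [h.mul_J_loop₂ hs, diag]
  rcases eq_or_ne y z with rfl | hyz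
  · rw [diag, mul_right_comm, h.mul_J_loop₂ hs, mul_right_comm]
  rcases eq_or_ne x y with rfl | hxy
  · rw [h.diagJ, mul_assoc, h.mul_K_loop₂ hs, mul_assoc]
  set D : ℤ → ℤ → ℤ → ℂ := fun x y z => J x y * K y z * K z x -
    c * lineCoeff a b y z * lineCoeff a b z x with hD
  have swap : ∀ x y y' z : ℤ, y + y' = x + z → x ≠ z → D x y z = D y' z x := by
    intro x y y' z e hne
    have e1 := h.kj_of_ne e hne
    have e2 := h.mul_J_loop₂ hs x z
    obtain rfl : y' = x + z - y := by omega
    simp only [hD]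
    unfold lineCoeff at e2 ⊢
    push_cast at e1 ⊢
    linear_combination e1 * K z x + ((y : ℂ) - x) * e2
  have swap' : ∀ x y z z' : ℤ, z + z' = x + y → x ≠ y → D x y z = D x y z' := by
    intro x y z z' e hne
    have e1 := h.kk_of_ne (show z + z' = y + x by omega) hne.symm
    have e2 := h.mul_J_loop₂ hs x y
    obtain rfl : z' = x + y - z := by omega
    simp only [hD]
    unfold lineCoeff at e2 ⊢
    push_cast at e1 ⊢
    linear_combination e1 * J x y + ((z : ℂ) - (x + y - z)) * e2
  have step : ∀ x y z : ℤ, x ≠ z → x ≠ y →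
      D x y z = D (x + (z - y)) (y + (z - y)) (z + (z - y)) := by
    intro x y z h1 h2
    rw [swap x y (x + z - y) z (by ring) h1,
      swap' (x + z - y) z x (2 * z - y) (by ring) (by omega)]
    congr 1 <;> ring
  have := eq_zero_of_periodic (D := fun t => D (x + t) (y + t) (z + t)) (p := z - y)
    (sub_ne_zero.mpr hyz.symm) (T := T + |x| + |y| + |z|) (fun t => by
      rw [step (x + t) (y + t) (z + t) (by omega) (by omega)]
      congr 1 <;> ring) (fun t ht => by
      have := neg_abs_le x
      have := neg_abs_le y
      have := neg_abs_le z
      have := abs_nonneg x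
      have := abs_nonneg y
      have := abs_nonneg z
      simp only [hD]
      rw [hs.J_eq _ _ (by omega) (by omega), hs.K_eq _ _ (by omega) (by omega),
        hs.K_eq _ _ (by omega) (by omega), sub_self]) 0
  simp only [add_zero] at this
  exact sub_eq_zero.mp this

end Loops

/-- After a rescaling, the structure constants are those of `𝒜_{a,b,c}` outside of the degrees
`x` with `a + x = 0`, and in all degrees if `b ≠ 0, 1`. -/
theorem exists_rescale_eq (h : Rep K J a 0 0 0 c) {b : ℂ} {T : ℤ}
    (hs : IsStandardFrom T K J a b c) :
    ∃ g : ℤ → ℂ, (∀ x, g x ≠ 0) ∧ ∀ x y : ℤ, (b * (1 - b) ≠ 0 ∨ a + x ≠ 0) →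
      (b * (1 - b) ≠ 0 ∨ a + y ≠ 0) →
      TwistedHV.rescale g K x y = lineCoeff a b x y ∧ TwistedHV.rescale g J x y = c := by
  -- The coefficients from x to z and from z to x are a + x + b(z - x) and a + x + (1 - b)(z - x).
  -- Each is affine in z, so it is nonzero for large z unless it vanishes identically.
  have P1 : ∀ x : ℤ, (b * (1 - b) ≠ 0 ∨ a + x ≠ 0) →
      ∃ S : ℤ, ∀ z, S ≤ z → lineCoeff a b x z ≠ 0 ∧ lineCoeff a b z x ≠ 0 := by
    have aux : ∀ (x : ℤ) (b : ℂ), (b ≠ 0 ∨ a + x ≠ 0) →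
        ∃ S : ℤ, ∀ z : ℤ, S ≤ z → a + x + b * (z - x) ≠ 0 := by
      intro x b hx
      by_cases hb : b = 0
      · refine ⟨0, fun z _ => ?_⟩
        simpa [hb] using hx
      · obtain ⟨S, hS⟩ := eventually_add_ne ((a + x) / b - x)
        refine ⟨S, fun z hz h0 => hS z hz ?_⟩
        field_simp
        linear_combination h0
    intro x hx
    obtain ⟨S, hS⟩ := aux x b (hx.imp_left left_ne_zero_of_mul)
    obtain ⟨S', hS'⟩ := aux x (1 - b) (hx.imp_left right_ne_zero_of_mul)
    refine ⟨max S S', fun z hz => ⟨hS z (by omega), fun h0 => hS' z (by omega) ?_⟩⟩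
    unfold lineCoeff at h0
    linear_combination h0
  have P2 : ∀ x : ℤ, ∃ g : ℂ, g ≠ 0 ∧ ((b * (1 - b) ≠ 0 ∨ a + x ≠ 0) →
      ∃ S : ℤ, ∀ z, S ≤ z → lineCoeff a b x z ≠ 0 ∧ lineCoeff a b z x ≠ 0 ∧
        K x z * g = lineCoeff a b x z ∧ K z x = lineCoeff a b z x * g) := by
    intro x
    by_cases hx : b * (1 - b) ≠ 0 ∨ a + x ≠ 0
    swap
    · exact ⟨1, one_ne_zero, fun h => absurd h hx⟩
    obtain ⟨S, hS⟩ := P1 x hx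
    -- The large degree w serves as a reference: the scale at x is the ratio of K w x to its
    -- standard value. Triangles w, x, z show that the same scale works for all large z.
    set w := max S T with hw
    obtain ⟨hw1, hw2⟩ := hS w (by omega)
    have hgood : ∃ S' : ℤ, ∀ z, S' ≤ z → lineCoeff a b z w ≠ 0 := by
      have hw' : b * (1 - b) ≠ 0 ∨ a + w ≠ 0 := by
        by_contra! hcon
        rcases mul_eq_zero.mp hcon.1 with hb | hb
        · refine hw2 ?_
          rw [lineCoeff, hb, hcon.2]
          ring
        · refine hw1 ?_
          rw [lineCoeff, show b = 1 by linear_combination -hb]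
          linear_combination hcon.2
      obtain ⟨S', hS'⟩ := P1 w hw'
      exact ⟨S', fun z hz => (hS' z hz).2⟩
    obtain ⟨S', hS'⟩ := hgood
    have hKw : K x w * K w x ≠ 0 := by
      rw [h.mul_K_loop₂ hs]
      exact mul_ne_zero hw1 hw2
    refine ⟨K w x / lineCoeff a b w x, div_ne_zero (right_ne_zero_of_mul hKw) hw2, fun _ =>
      ⟨max (max S S') T, fun z hz => ?_⟩⟩
    obtain ⟨hz1, hz2⟩ := hS z (by omega)
    have e1 := h.mul_K_loop₃ hs w x z
    rw [hs.K_eq z w (by omega) (by omega)] at e1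
    have e2 := mul_right_cancel₀ (hS' z (by omega)) e1
    have e3 := h.mul_K_loop₂ hs x z
    have hKx : K x z ≠ 0 := by
      refine left_ne_zero_of_mul (b := K z x) ?_
      rw [e3]
      exact mul_ne_zero hz1 hz2
    refine ⟨hz1, hz2, ?_, ?_⟩
    · field_simp
      linear_combination e2
    · field_simp
      refine mul_left_cancel₀ hKx ?_
      linear_combination lineCoeff a b w x * e3 - lineCoeff a b z x * e2
  choose g hg hgS using P2
  refine ⟨g, hg, fun x y hx hy => ?_⟩
  obtain ⟨S, hS⟩ := hgS x hx
  obtain ⟨S', hS'⟩ := hgS y hy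
  -- The arrow x → y is closed to a triangle through a remote z, whose other two edges are nonzero
  -- and standard up to the scales at x and y.
  obtain ⟨x1, x2, x3, x4⟩ := hS (max S S') (by omega)
  obtain ⟨y1, y2, y3, y4⟩ := hS' (max S S') (by omega)
  set z := max S S'
  have gx := hg x
  have gy := hg y
  have e1 := h.mul_K_loop₃ hs x y z
  have e2 := h.mul_J_loop₃ hs x y z
  unfold TwistedHV.rescale
  rw [div_eq_iff gy, div_eq_iff gy]
  constructor
  · refine mul_right_cancel₀ (mul_ne_zero y1 x2) ?_
    linear_combination g y * e1 - g y * K x y * K y z * x4 - K x y * lineCoeff a b z x * g x * y3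
  · refine mul_right_cancel₀ (mul_ne_zero y1 x2) ?_
    linear_combination g y * e2 - g y * J x y * K y z * x4 - J x y * lineCoeff a b z x * g x * y3

end Rep
end TwistedHV

namespace TwistedHV

/-! ### Classification of the structure constants -/

/-- The structure constants are those of `k` after a shift and a rescaling of the basis. -/
def Matches (k : Coeffs) (K J : ℤ → ℤ → ℂ) : Prop :=
  ∃ (o : ℤ) (g : ℤ → ℂ), (∀ x, g x ≠ 0) ∧ ∀ x y,
    K (x + o) (y + o) * g x = k.l (y - x) x * g y ∧
    J (x + o) (y + o) * g x = k.i (y - x) x * g y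

/-- The structure constants are those of one of the seven families. -/
def Classified (K J : ℤ → ℤ → ℂ) : Prop :=
  (∃ a b c : ℂ, Matches (modA a b c) K J) ∨ (∃ a d : ℂ, Matches (modAd a d) K J) ∨
    (∃ a d : ℂ, Matches (modB a d) K J) ∨ (∃ d : ℂ, Matches (modU d) K J) ∨
    (∃ d : ℂ, Matches (modV d) K J) ∨ (∃ d : ℂ, d ≠ 0 ∧ Matches (modUtilde d) K J) ∨
    (∃ c : ℂ, c ≠ 0 ∧ Matches (modVtilde c) K J)

theorem Classified.of_matches {K J K' J' : ℤ → ℤ → ℂ}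
    (h : ∀ k, Matches k K' J' → Matches k K J) (hc : Classified K' J') : Classified K J :=
  hc.imp (fun ⟨a, b, c, H⟩ => ⟨a, b, c, h _ H⟩) <| .imp (fun ⟨a, d, H⟩ => ⟨a, d, h _ H⟩) <|
    .imp (fun ⟨a, d, H⟩ => ⟨a, d, h _ H⟩) <| .imp (fun ⟨d, H⟩ => ⟨d, h _ H⟩) <|
    .imp (fun ⟨d, H⟩ => ⟨d, h _ H⟩) <|
    .imp (fun ⟨d, hd, H⟩ => ⟨d, hd, h _ H⟩) fun ⟨c, hd, H⟩ => ⟨c, hd, h _ H⟩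

theorem Matches.of_rescale {k : Coeffs} {K J : ℤ → ℤ → ℂ} {g : ℤ → ℂ} (hg : ∀ x, g x ≠ 0)
    (h : Matches k (rescale g K) (rescale g J)) : Matches k K J := by
  obtain ⟨o, f, hf, H⟩ := h
  refine ⟨o, fun x => g (x + o) * f x, fun x => mul_ne_zero (hg _) (hf _), fun x y => ?_⟩
  obtain ⟨h1, h2⟩ := H x y
  have := hg (y + o)
  unfold rescale at h1 h2
  field_simp at h1 h2
  constructor
  · linear_combination h1
  · linear_combination h2

theorem Matches.of_shift {k : Coeffs} {K J : ℤ → ℤ → ℂ} {o : ℤ}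
    (h : Matches k (fun x y => K (x + o) (y + o)) (fun x y => J (x + o) (y + o))) :
    Matches k K J := by
  obtain ⟨p, f, hf, H⟩ := h
  refine ⟨p + o, f, hf, fun x y => ?_⟩
  simpa only [← add_assoc] using H x y

/-- The functions `φ` with `n φ(n) - m φ(m) = (n - m) φ(n + m)` are affine. -/
theorem exists_affine {φ : ℤ → ℂ} (h : ∀ n m : ℤ, n ≠ 0 → m ≠ 0 → n + m ≠ 0 →
    n * φ n - m * φ m = ((n : ℂ) - m) * φ (n + m)) :
    ∃ α β : ℂ, ∀ n : ℤ, n ≠ 0 → φ n = α * n + β := by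
  refine ⟨φ 2 - φ 1, 2 * φ 1 - φ 2, ?_⟩
  have two : ∀ n : ℕ, 2 ≤ n → φ n = (φ 2 - φ 1) * n + (2 * φ 1 - φ 2) := by
    intro n hn
    induction n, hn using Nat.le_induction with
    | base => push_cast; ring
    | succ n hn ih =>
      have e := h n 1 (by omega) (by omega) (by omega)
      have hn' : (n : ℂ) - 1 ≠ 0 := by
        rw [sub_ne_zero]
        exact_mod_cast (show n ≠ 1 by omega)
      refine mul_left_cancel₀ hn' ?_
      push_cast at e ⊢
      linear_combination -e + n * ih
  have pos : ∀ n : ℕ, 1 ≤ n → φ n = (φ 2 - φ 1) * n + (2 * φ 1 - φ 2) := by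
    intro n hn
    rcases hn.eq_or_lt with rfl | hn
    · push_cast; ring
    · exact two n hn
  intro n hn
  rcases lt_or_gt_of_ne hn with hlt | hgt
  · obtain ⟨k, rfl⟩ : ∃ k : ℕ, n = -k := ⟨n.natAbs, by omega⟩
    have e := h (-k) (k + 1) (by omega) (by omega) (by omega)
    have e' := pos (k + 1) (by omega)
    have hk : (k : ℂ) ≠ 0 := by exact_mod_cast (show k ≠ 0 by omega)
    rw [show -(k : ℤ) + (k + 1) = 1 by ring] at e
    refine mul_left_cancel₀ hk ?_
    push_cast at e e' ⊢
    linear_combination -e - (k + 1) * e'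
  · obtain ⟨k, rfl⟩ : ∃ k : ℕ, n = k := ⟨n.natAbs, by omega⟩
    have := pos k (by omega)
    push_cast at this ⊢
    exact this

/-- Among n = 1, 2, 3, one of the factors vanishes twice, and an affine function with two zeros is
zero. -/
theorem affine_eq_zero_or {α β γ δ : ℂ}
    (h : ∀ n : ℤ, n ≠ 0 → (α * n + β) * (γ * n + δ) = 0) :
    (α = 0 ∧ β = 0) ∨ (γ = 0 ∧ δ = 0) := by
  have h1 := h 1 (by omega)
  have h2 := h 2 (by omega)
  have h3 := h 3 (by omega)
  push_cast at h1 h2 h3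
  rcases mul_eq_zero.mp h1 with h1 | h1 <;> rcases mul_eq_zero.mp h2 with h2 | h2 <;>
    rcases mul_eq_zero.mp h3 with h3 | h3 <;> first
    | exact Or.inl ⟨by linear_combination h2 - h1, by linear_combination 2 * h1 - h2⟩
    | exact Or.inr ⟨by linear_combination h2 - h1, by linear_combination 2 * h1 - h2⟩
    | exact Or.inl ⟨by linear_combination h3 - h2, by linear_combination 3 * h2 - 2 * h3⟩
    | exact Or.inr ⟨by linear_combination h3 - h2, by linear_combination 3 * h2 - 2 * h3⟩
    | exact Or.inl ⟨by linear_combination (h3 - h1) / 2, by linear_combination (3 * h1 - h3) / 2⟩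
    | exact Or.inr ⟨by linear_combination (h3 - h1) / 2, by linear_combination (3 * h1 - h3) / 2⟩

/-- No proper nonempty set of degrees is stable under the action together with its complement. -/
def IsConnected (K J : ℤ → ℤ → ℂ) : Prop :=
  ∀ S : Set ℤ, (∀ x y, K x y ≠ 0 ∨ J x y ≠ 0 → (x ∈ S ↔ y ∈ S)) → S = ∅ ∨ S = Set.univ

theorem IsConnected.rescale {K J : ℤ → ℤ → ℂ} {g : ℤ → ℂ} (hg : ∀ x, g x ≠ 0)
    (h : IsConnected K J) : IsConnected (rescale g K) (rescale g J) := by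
  refine fun S hS => h S fun x y hxy => hS x y ?_
  exact hxy.imp (fun hK => div_ne_zero (mul_ne_zero hK (hg x)) (hg y))
    (fun hJ => div_ne_zero (mul_ne_zero hJ (hg x)) (hg y))

theorem IsConnected.shift {K J : ℤ → ℤ → ℂ} (h : IsConnected K J) (o : ℤ) :
    IsConnected (fun x y => K (x + o) (y + o)) (fun x y => J (x + o) (y + o)) := by
  intro S hS
  have := h ((fun x => x - o) ⁻¹' S) fun x y hxy => by
    simpa using hS (x - o) (y - o) (by simpa using hxy)
  rcases this with h0 | h0
  · left
    ext x
    simpa using Set.ext_iff.mp h0 (x + o)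
  · right
    ext x
    simpa using Set.ext_iff.mp h0 (x + o)

/-! ### The exceptional degree, moved to 0 -/

namespace Rep

variable {K J : ℤ → ℤ → ℂ} {a κ lam mu c : ℂ}

theorem shift (h : Rep K J a κ lam mu c) (o : ℤ) :
    Rep (fun x y => K (x + o) (y + o)) (fun x y => J (x + o) (y + o)) (a + o) κ lam mu c where
  diagK x := by
    rw [h.diagK]
    push_cast
    ring
  diagJ x := h.diagJ _
  kk x y y' z e := by
    have := h.kk (x + o) (y + o) (y' + o) (z + o) (by omega)
    simpa using this
  kj x y y' z e := by
    have := h.kj (x + o) (y + o) (y' + o) (z + o) (by omega)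
    simpa using this
  jj x y y' z e := by
    have := h.jj (x + o) (y + o) (y' + o) (z + o) (by omega)
    simpa using this

/-- Since J 0 n * K n 0 = c n ≠ 0, no K n 0 vanishes. The loop relation gives K n 0 * K 0 n = 0, so
every K 0 n does. Then J 0 n is independent of n, commutativity of the I's fixes J n 0, and
rescaling v_0 alone finishes. -/
theorem matches_modA_zero (h : Rep K J 0 0 0 0 c) (hc : c ≠ 0)
    (hK : ∀ x y : ℤ, x ≠ 0 → y ≠ 0 → K x y = x) (hJ : ∀ x y : ℤ, x ≠ 0 → y ≠ 0 → J x y = c) :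
    Matches (modA 0 0 c) K J := by
  have cast0 : ∀ {n : ℤ}, n ≠ 0 → (n : ℂ) ≠ 0 := fun hn => Int.cast_ne_zero.mpr hn
  have e1 : ∀ n : ℤ, n ≠ 0 → J 0 n * K n 0 = c * n := fun n hn => by
    have e := h.kj_loop (x := n) (y := 2 * n) (y' := 0) (by ring)
    rw [hJ _ _ hn (by omega), hK _ _ (by omega) hn] at e
    push_cast at e
    linear_combination -e
  have e2 : ∀ n : ℤ, n ≠ 0 → K 0 n = 0 := fun n hn => by
    have e := h.kk_loop (x := n) (y := 2 * n) (y' := 0) (by ring)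
    rw [hK _ _ hn (by omega), hK _ _ (by omega) hn] at e
    have e' : K n 0 ≠ 0 := right_ne_zero_of_mul ((e1 n hn).trans_ne (mul_ne_zero hc (cast0 hn)))
    refine mul_left_cancel₀ e' ?_
    push_cast at e
    linear_combination -e
  have e3 : ∀ n : ℤ, n ≠ 0 → J 0 n = J 0 1 := fun n hn => by
    rcases eq_or_ne n 1 with rfl | hn1
    · rfl
    · have e := h.kj_of_ne (x := 0) (y := n) (y' := 1 - n) (z := 1) (by ring) (by omega)
      rw [hK _ _ hn (by omega), e2 _ (by omega)] at e
      refine mul_left_cancel₀ (cast0 hn) ?_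
      push_cast at e
      linear_combination e
  have e0 : J 0 1 ≠ 0 := left_ne_zero_of_mul ((e1 1 one_ne_zero).trans_ne (by simpa using hc))
  have e4 : ∀ n : ℤ, n ≠ 0 → J n 0 * J 0 1 = c * c := fun n hn => by
    -- The second path runs through 3n, so it avoids degree 0 and its coefficients are known.
    have e := h.jj_of_ne (x := n) (y := 0) (y' := 3 * n) (z := 2 * n) (by ring) (by omega)
    rwa [e3 _ (by omega), hJ n (3 * n) hn (by omega), hJ (3 * n) _ (by omega) (by omega)] at e
  refine ⟨0, fun x => if x = 0 then c / J 0 1 else 1, fun x => ?_, fun x y => ?_⟩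
  · beta_reduce
    split_ifs
    · exact div_ne_zero hc e0
    · exact one_ne_zero
  · simp only [modA, add_zero]
    rcases eq_or_ne x 0 with rfl | hx <;> rcases eq_or_ne y 0 with rfl | hy
    · simp [h.diagK, h.diagJ]
    · simp only [if_pos, if_neg hy, e2 y hy, e3 y hy]
      field_simp
      simp
    · have f1 := e1 x hx
      rw [e3 x hx] at f1
      have f2 := e4 x hx
      simp only [if_pos, if_neg hx]
      field_simp
      constructor
      · linear_combination f1
      · linear_combination f2
    · simp [hx, hy, hK x y hx hy, hJ x y hx hy]

/-- This is the mirror image of `matches_modA_zero`, with arrows into and out of degree 0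
interchanged. -/
theorem matches_modA_one (h : Rep K J 0 0 0 0 c) (hc : c ≠ 0)
    (hK : ∀ x y : ℤ, x ≠ 0 → y ≠ 0 → K x y = y) (hJ : ∀ x y : ℤ, x ≠ 0 → y ≠ 0 → J x y = c) :
    Matches (modA 0 1 c) K J := by
  have cast0 : ∀ {n : ℤ}, n ≠ 0 → (n : ℂ) ≠ 0 := fun hn => Int.cast_ne_zero.mpr hn
  have e1 : ∀ n : ℤ, n ≠ 0 → J n 0 * K 0 n = c * n := fun n hn => by
    have e := h.kj_loop (x := n) (y := 0) (y' := 2 * n) (by ring)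
    rw [hJ _ _ (by omega) hn, hK _ _ hn (by omega)] at e
    push_cast at e
    linear_combination e
  have e2 : ∀ n : ℤ, n ≠ 0 → K n 0 = 0 := fun n hn => by
    have e := h.kk_loop (x := n) (y := 2 * n) (y' := 0) (by ring)
    rw [hK _ _ hn (by omega), hK _ _ (by omega) hn] at e
    have e' : K 0 n ≠ 0 := right_ne_zero_of_mul ((e1 n hn).trans_ne (mul_ne_zero hc (cast0 hn)))
    refine mul_left_cancel₀ e' ?_
    push_cast at e
    linear_combination -e
  have e3 : ∀ n : ℤ, n ≠ 0 → J n 0 = J 1 0 := fun n hn => by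
    rcases eq_or_ne n 1 with rfl | hn1
    · rfl
    · have e := h.kj_of_ne (x := 1) (y := 1 - n) (y' := n) (z := 0) (by ring) (by omega)
      rw [hK _ _ one_ne_zero hn, e2 _ (by omega)] at e
      refine mul_left_cancel₀ (cast0 hn) ?_
      push_cast at e
      linear_combination -e
  have e0 : J 1 0 ≠ 0 := left_ne_zero_of_mul ((e1 1 one_ne_zero).trans_ne (by simpa using hc))
  have e4 : ∀ n : ℤ, n ≠ 0 → J 0 n * J 1 0 = c * c := fun n hn => by
    have e := h.jj_of_ne (x := 2 * n) (y := 0) (y' := 3 * n) (z := n) (by ring) (by omega)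
    rw [e3 _ (by omega), hJ _ (3 * n) (by omega) (by omega), hJ (3 * n) n (by omega) hn] at e
    linear_combination e
  refine ⟨0, fun x => if x = 0 then J 1 0 / c else 1, fun x => ?_, fun x y => ?_⟩
  · beta_reduce
    split_ifs
    · exact div_ne_zero e0 hc
    · exact one_ne_zero
  · simp only [modA, add_zero]
    rcases eq_or_ne x 0 with rfl | hx <;> rcases eq_or_ne y 0 with rfl | hy
    · simp [h.diagK, h.diagJ]
    · have f1 := e1 y hy
      rw [e3 y hy] at f1
      have f2 := e4 y hy
      simp only [if_pos, if_neg hy]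
      push_cast
      field_simp
      constructor
      · linear_combination f1
      · linear_combination f2
    · simp only [if_pos, if_neg hx, e2 x hx, e3 x hx]
      push_cast
      field_simp
      simp
    · simp [hx, hy, hK x y hx hy, hJ x y hx hy]

/-- The unknowns are the arrows at degree 0: K 0 n = αn + β, K n 0 = n(γn - δ), J n 0 = -dn, J 0 n =
e. Paths through 0 give four alternatives: (α,β) or (γ,δ) vanishes, d or e vanishes, d or (α,β)
vanishes, e or (γ,δ) vanishes. The surviving cases are the six families other than 𝒜_{a,b,c}. -/
theorem classified_of_I_zero (h : Rep K J 0 0 0 0 0) (hcon : IsConnected K J)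
    (hK : ∀ x y : ℤ, x ≠ 0 → y ≠ 0 → K x y = x) (hJ : ∀ x y : ℤ, x ≠ 0 → y ≠ 0 → J x y = 0) :
    Classified K J := by
  have cast0 : ∀ {n : ℤ}, n ≠ 0 → (n : ℂ) ≠ 0 := fun hn => Int.cast_ne_zero.mpr hn
  have K00 : K 0 0 = 0 := by simpa using h.diagK 0
  have J00 : J 0 0 = 0 := h.diagJ 0
  obtain ⟨α, β, hφ⟩ := exists_affine (φ := fun n => K 0 n) fun n m hn hm hnm => by
    have e := h.kk_of_ne (x := 0) (y := n) (y' := m) (z := n + m) (by ring) hnm.symm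
    rw [hK _ _ hn hnm, hK _ _ hm hnm] at e
    linear_combination e
  -- Division by n brings the relation for the arrows into 0 to the same functional equation as for
  -- the arrows out of 0.
  obtain ⟨γ, δ, hψ⟩ := exists_affine (φ := fun n => K (-n) 0 / n) fun n m hn hm hnm => by
    have e := h.kk_of_ne (x := -(n + m)) (y := -m) (y' := -n) (z := 0) (by ring) (by omega)
    rw [hK _ (-m) (by omega) (by omega), hK _ (-n) (by omega) (by omega)] at e
    have h1 := cast0 hn
    have h2 := cast0 hm
    have h3 := cast0 hnm
    push_cast at e h3 ⊢
    field_simp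
    linear_combination e
  have hψ' : ∀ n : ℤ, n ≠ 0 → K n 0 = n * (γ * n - δ) := fun n hn => by
    have e := hψ (-n) (by omega)
    have h1 := cast0 hn
    rw [neg_neg] at e
    push_cast at e
    field_simp at e
    linear_combination -e
  have hφψ := affine_eq_zero_or (α := α) (β := β) (γ := γ) (δ := -δ) fun n hn => by
    have e := h.kk_loop (x := n) (y := 2 * n) (y' := 0) (by ring)
    rw [hK _ _ hn (by omega), hK _ _ (by omega) hn, hφ n hn, hψ' n hn] at e
    refine mul_left_cancel₀ (cast0 hn) ?_
    push_cast at e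
    linear_combination -e
  obtain ⟨d, hd⟩ : ∃ d : ℂ, ∀ n : ℤ, n ≠ 0 → J n 0 = -d * n := by
    refine ⟨J (-1) 0, fun n hn => ?_⟩
    rcases eq_or_ne n (-1) with rfl | hn1
    · push_cast
      ring
    · have e := h.kj_of_ne (x := n) (y := n + 1) (y' := -1) (z := 0) (by ring) hn
      rw [hJ _ _ hn (by omega), hK _ _ hn (by omega)] at e
      push_cast at e
      linear_combination -e
  obtain ⟨e, he⟩ : ∃ e : ℂ, ∀ n : ℤ, n ≠ 0 → J 0 n = e := by
    refine ⟨J 0 1, fun n hn => ?_⟩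
    rcases eq_or_ne n 1 with rfl | hn1
    · rfl
    · have e := h.kj_of_ne (x := 0) (y := n) (y' := 1 - n) (z := 1) (by ring) (by omega)
      rw [hK _ _ hn (by omega), hJ (1 - n) _ (by omega) (by omega)] at e
      refine mul_left_cancel₀ (cast0 hn) ?_
      push_cast at e
      linear_combination e
  have hde : d = 0 ∨ e = 0 := by
    have f := h.jj_of_ne (x := 1) (y := 0) (y' := 3) (z := 2) (by ring) (by omega)
    rw [hd 1 (by omega), he 2 (by omega), hJ 1 3 (by omega) (by omega), zero_mul] at f
    simpa using f
  have hdφ : d = 0 ∨ (α = 0 ∧ β = 0) := by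
    have f : ∀ n : ℤ, n ≠ 0 → d * (α * n + β) = 0 := fun n hn => by
      have f := h.kj_loop (x := n) (y := 0) (y' := 2 * n) (by ring)
      rw [hJ (2 * n) n (by omega) hn, hd n hn, hφ n hn] at f
      refine mul_left_cancel₀ (cast0 hn) ?_
      linear_combination -f
    have := affine_eq_zero_or (α := 0) (β := d) (γ := α) (δ := β) fun n hn => by
      linear_combination f n hn
    exact this.imp_left And.right
  have heψ : e = 0 ∨ (γ = 0 ∧ δ = 0) := by
    have f : ∀ n : ℤ, n ≠ 0 → e * (γ * n - δ) = 0 := fun n hn => by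
      have f := h.kj_loop (x := n) (y := 2 * n) (y' := 0) (by ring)
      rw [hJ n (2 * n) hn (by omega), he n hn, hψ' n hn] at f
      refine mul_left_cancel₀ (cast0 hn) ?_
      linear_combination -f
    have := affine_eq_zero_or (α := 0) (β := e) (γ := γ) (δ := -δ) fun n hn => by
      linear_combination f n hn
    simpa using this
  -- Otherwise degree 0 would be isolated, against connectedness.
  have hne : ¬((α = 0 ∧ β = 0) ∧ (γ = 0 ∧ δ = 0) ∧ d = 0 ∧ e = 0) := by
    rintro ⟨⟨rfl, rfl⟩, ⟨rfl, rfl⟩, rfl, rfl⟩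
    have hS : ∀ x y : ℤ, K x y ≠ 0 ∨ J x y ≠ 0 → (x ∈ ({0} : Set ℤ) ↔ y ∈ ({0} : Set ℤ)) := by
      intro x y hxy
      rcases eq_or_ne x 0 with rfl | hx <;> rcases eq_or_ne y 0 with rfl | hy
      · rfl
      · simp [hφ y hy, he y hy] at hxy
      · simp [hψ' x hx, hd x hx] at hxy
      · simp [hx, hy]
    rcases hcon {0} hS with h0 | h0
    · exact Set.singleton_ne_empty _ h0
    · exact one_ne_zero (Set.eq_univ_iff_forall.mp h0 (1 : ℤ))
  have mk : ∀ (k : Coeffs) (g : ℤ → ℂ), (∀ x, g x ≠ 0) → k.l 0 0 = 0 → k.i 0 0 = 0 →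
      (∀ n : ℤ, n ≠ 0 → (α * n + β) * g 0 = k.l n 0 * g n ∧ e * g 0 = k.i n 0 * g n) →
      (∀ n : ℤ, n ≠ 0 → n * (γ * n - δ) * g n = k.l (-n) n * g 0 ∧
        -d * n * g n = k.i (-n) n * g 0) →
      (∀ x y : ℤ, x ≠ 0 → y ≠ 0 → x * g x = k.l (y - x) x * g y ∧ 0 = k.i (y - x) x * g y) →
      Matches k K J := by
    intro k g hg h1 h2 h3 h4 h5
    refine ⟨0, g, hg, fun x y => ?_⟩
    rw [add_zero, add_zero]
    rcases eq_or_ne x 0 with rfl | hx <;> rcases eq_or_ne y 0 with rfl | hy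
    · simp [K00, J00, h1, h2]
    · rw [sub_zero, hφ y hy, he y hy]
      exact h3 y hy
    · rw [zero_sub, hψ' x hx, hd x hx]
      exact h4 x hx
    · rw [hK x y hx hy, hJ x y hx hy, zero_mul]
      exact h5 x y hx hy
  have gne : ∀ {w : ℂ}, w ≠ 0 → ∀ x : ℤ, (if x = 0 then w else 1) ≠ 0 := fun hw x => by
    split_ifs
    · exact hw
    · exact one_ne_zero
  -- Dividing v_x by x away from 0 changes the coefficient t of L(n) v_t into t + n, the form used
  -- in 𝒜(a,d) and 𝒱_d.
  have gne' : ∀ {w : ℂ}, w ≠ 0 → ∀ x : ℤ, (if x = 0 then w else (x : ℂ)⁻¹) ≠ 0 := fun hw x => by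
    split_ifs with hx
    · exact hw
    · exact inv_ne_zero (cast0 hx)
  by_cases hφ0 : α = 0 ∧ β = 0
  · obtain ⟨rfl, rfl⟩ := hφ0
    by_cases hψ0 : γ = 0 ∧ δ = 0
    · obtain ⟨rfl, rfl⟩ := hψ0
      rcases hde with rfl | rfl
      · rcases eq_or_ne e 0 with rfl | he0
        · exact absurd ⟨⟨rfl, rfl⟩, ⟨rfl, rfl⟩, rfl, rfl⟩ hne
        · refine .inr <| .inr <| .inr <| .inr <| .inr <| .inr ⟨e, he0, mk _ (fun _ => 1)
            (fun _ => one_ne_zero) ?_ ?_ ?_ ?_ ?_⟩ <;> simp +contextual [modVtilde]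
      · rcases eq_or_ne d 0 with rfl | hd0
        · exact absurd ⟨⟨rfl, rfl⟩, ⟨rfl, rfl⟩, rfl, rfl⟩ hne
        · refine .inr <| .inr <| .inr <| .inr <| .inr <| .inl ⟨d, hd0, mk _ (fun _ => 1)
            (fun _ => one_ne_zero) ?_ ?_ ?_ ?_ ?_⟩ <;> simp +contextual [modUtilde]
    · obtain rfl := heψ.resolve_right hψ0
      rcases eq_or_ne γ 0 with rfl | hγ
      · have hδ : δ ≠ 0 := fun h0 => hψ0 ⟨rfl, h0⟩
        refine .inr <| .inr <| .inr <| .inl ⟨d / -δ, mk _ (fun x => if x = 0 then -δ else 1)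
          (gne (neg_ne_zero.mpr hδ)) ?_ ?_ ?_ ?_ ?_⟩ <;> simp +contextual [modU]
        intro n hn
        field_simp
      · refine .inr <| .inr <| .inl ⟨δ / γ, d / -γ, mk _ (fun x => if x = 0 then -γ else 1)
          (gne (neg_ne_zero.mpr hγ)) ?_ ?_ ?_ ?_ ?_⟩ <;> simp +contextual [modB]
        intro n hn
        constructor
        · field_simp
          ring
        · field_simp
  · obtain rfl := hdφ.resolve_right hφ0
    obtain ⟨rfl, hδ⟩ := hφψ.resolve_left hφ0
    obtain rfl : δ = 0 := neg_eq_zero.mp hδ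
    rcases eq_or_ne α 0 with rfl | hα
    · have hβ : β ≠ 0 := fun h0 => hφ0 ⟨rfl, h0⟩
      refine .inr <| .inr <| .inr <| .inr <| .inl ⟨e / β, mk _
        (fun x => if x = 0 then β⁻¹ else (x : ℂ)⁻¹) (gne' (inv_ne_zero hβ)) ?_ ?_ ?_ ?_ ?_⟩ <;>
        simp +contextual [modV]
      intro n hn
      have := cast0 hn
      field_simp
      simp
    · refine .inr <| .inl ⟨β / α, e / α, mk _
        (fun x => if x = 0 then α⁻¹ else (x : ℂ)⁻¹) (gne' (inv_ne_zero hα)) ?_ ?_ ?_ ?_ ?_⟩ <;>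
        simp +contextual [modAd]
      intro n hn
      have := cast0 hn
      constructor
      · field_simp
      · field_simp

theorem classified (h : Rep K J a κ lam mu c) (hcon : IsConnected K J) :
    κ = 0 ∧ lam = 0 ∧ mu = 0 ∧ Classified K J := by
  obtain ⟨rfl, rfl, rfl, b, g, hg, T, hs⟩ := h.exists_rescale_isStandardFrom
  refine ⟨rfl, rfl, rfl, ?_⟩
  refine Classified.of_matches (fun k => Matches.of_rescale hg) ?_
  replace h := h.rescale hg
  replace hcon := hcon.rescale hg
  generalize TwistedHV.rescale g K = K' at *
  generalize TwistedHV.rescale g J = J' at *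
  clear hg g K J
  obtain ⟨g, hg, hgS⟩ := h.exists_rescale_eq hs
  refine Classified.of_matches (fun k => Matches.of_rescale hg) ?_
  replace h := h.rescale hg
  replace hcon := hcon.rescale hg
  clear hs
  generalize TwistedHV.rescale g K' = K at *
  generalize TwistedHV.rescale g J' = J at *
  clear hg g K' J'
  by_cases hall : ∀ x : ℤ, b * (1 - b) ≠ 0 ∨ a + x ≠ 0
  · refine .inl ⟨a, b, c, 0, fun _ => 1, fun _ => one_ne_zero, fun x y => ?_⟩
    obtain ⟨h1, h2⟩ := hgS x y (hall x) (hall y)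
    simp [modA, h1, h2, lineCoeff]
  push Not at hall
  obtain ⟨o, hb, ho⟩ := hall
  refine Classified.of_matches (fun k => Matches.of_shift (o := o)) ?_
  replace h := h.shift o
  replace hcon := hcon.shift o
  rw [ho] at h
  have good : ∀ x : ℤ, x ≠ 0 → b * (1 - b) ≠ 0 ∨ a + (x + o : ℤ) ≠ 0 := fun x hx =>
    .inr fun h0 => hx <| by
      push_cast at h0
      exact_mod_cast (show (x : ℂ) = 0 by linear_combination h0 - ho)
  have hK : ∀ x y : ℤ, x ≠ 0 → y ≠ 0 → K (x + o) (y + o) = x + b * (y - x) := fun x y hx hy => by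
    rw [(hgS _ _ (good x hx) (good y hy)).1, lineCoeff]
    push_cast
    linear_combination ho
  have hJ : ∀ x y : ℤ, x ≠ 0 → y ≠ 0 → J (x + o) (y + o) = c := fun x y hx hy =>
    (hgS _ _ (good x hx) (good y hy)).2
  rcases mul_eq_zero.mp hb with rfl | hb
  · rcases eq_or_ne c 0 with rfl | hc
    · exact h.classified_of_I_zero hcon (fun x y hx hy => by simp [hK x y hx hy]) hJ
    · exact .inl ⟨0, 0, c, h.matches_modA_zero hc (fun x y hx hy => by simp [hK x y hx hy]) hJ⟩
  · obtain rfl : b = 1 := by linear_combination -hb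
    rcases eq_or_ne c 0 with rfl | hc
    · have hg : ∀ x : ℤ, (if x = 0 then 1 else (x : ℂ)) ≠ 0 := fun x => by
        split_ifs with hx
        · exact one_ne_zero
        · exact_mod_cast hx
      refine Classified.of_matches (fun k => Matches.of_rescale hg) ?_
      refine (h.rescale hg).classified_of_I_zero (hcon.rescale hg) (fun x y hx hy => ?_)
        fun x y hx hy => ?_
      · have : (y : ℂ) ≠ 0 := by exact_mod_cast hy
        simp only [TwistedHV.rescale, hK x y hx hy, if_neg hx, if_neg hy]
        field_simp
        ring
      · simp only [TwistedHV.rescale, hJ x y hx hy, zero_mul, zero_div]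
    · exact .inl ⟨0, 1, c, h.matches_modA_one hc (fun x y hx hy => by simp [hK x y hx hy]) hJ⟩

end Rep
end TwistedHV

/-! ### From modules to structure constants and back -/

namespace TwistedHV

section Module

variable {V : Type*} [AddCommGroup V] [LieRingModule HV V]

theorem lie_gen_gen (g h : Gen) : ⁅gen g, gen h⁆ = genBracket g h := bracketMap_gen g h

theorem lie_genBracket (g h : Gen) (w : V) :
    ⁅genBracket g h, w⁆ = ⁅gen g, ⁅gen h, w⁆⁆ - ⁅gen h, ⁅gen g, w⁆⁆ := by
  rw [← lie_gen_gen, lie_lie]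

variable [Module ℂ V]

/-- The structure constants of a graded module. -/
theorem exists_structure_constants (v : Module.Basis ℤ ℂ V)
    (hgr : ∀ (m n : ℤ), ∀ x ∈ component m, ⁅x, v n⁆ ∈ Submodule.span ℂ {v (m + n)}) :
    ∃ (K J : ℤ → ℤ → ℂ) (κ μ lam : ℤ → ℂ),
      (∀ m n, ⁅gen (.L m), v n⁆ = K n (m + n) • v (m + n)) ∧
      (∀ m n, ⁅gen (.I m), v n⁆ = J n (m + n) • v (m + n)) ∧
      (∀ n, ⁅gen .CL, v n⁆ = κ n • v n) ∧ (∀ n, ⁅gen .CI, v n⁆ = μ n • v n) ∧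
      (∀ n, ⁅gen .CLI, v n⁆ = lam n • v n) := by
  have hL : ∀ x y : ℤ, ∃ r : ℂ, r • v y = ⁅gen (.L (y - x)), v x⁆ := fun x y => by
    have := hgr (y - x) x (gen (.L (y - x))) (Submodule.subset_span (by simp))
    rwa [sub_add_cancel, Submodule.mem_span_singleton] at this
  have hI : ∀ x y : ℤ, ∃ r : ℂ, r • v y = ⁅gen (.I (y - x)), v x⁆ := fun x y => by
    have := hgr (y - x) x (gen (.I (y - x))) (Submodule.subset_span (by simp))
    rwa [sub_add_cancel, Submodule.mem_span_singleton] at this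
  have hC : ∀ g : Gen, (g = .CL ∨ g = .CI ∨ g = .CLI) → ∀ x : ℤ, ∃ r : ℂ, r • v x = ⁅gen g, v x⁆ :=
    fun g hg x => by
      have := hgr 0 x (gen g) (Submodule.subset_span (by
        rcases hg with rfl | rfl | rfl <;> simp))
      rwa [zero_add, Submodule.mem_span_singleton] at this
  choose K hK using hL
  choose J hJ using hI
  choose κ hκ using hC .CL (by simp)
  choose μ hμ using hC .CI (by simp)
  choose lam hlam using hC .CLI (by simp)
  refine ⟨K, J, κ, μ, lam, fun m n => ?_, fun m n => ?_, fun n => (hκ n).symm,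
    fun n => (hμ n).symm, fun n => (hlam n).symm⟩
  · rw [hK, add_sub_cancel_right]
  · rw [hJ, add_sub_cancel_right]

variable [LieModule ℂ HV V]

theorem lie_mem_of_gen (p : Submodule ℂ V) {w : V} (h : ∀ g, ⁅gen g, w⁆ ∈ p) (x : HV) :
    ⁅x, w⁆ ∈ p := by
  induction x using gen_induction with
  | zero => simp
  | add x y hx hy =>
    rw [add_lie]
    exact p.add_mem hx hy
  | smul c g =>
    rw [smul_lie]
    exact p.smul_mem c (h g)

/-- The submodule spanned by part of a basis which is stable under the basis of the algebra. -/
def spanSubmodule (v : Module.Basis ℤ ℂ V) (S : Set ℤ)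
    (h : ∀ g, ∀ x ∈ S, ⁅gen g, v x⁆ ∈ Submodule.span ℂ (v '' S)) : LieSubmodule ℂ HV V :=
  { Submodule.span ℂ (v '' S) with
    lie_mem := by
      intro x w hw
      change w ∈ Submodule.span ℂ (v '' S) at hw
      change ⁅x, w⁆ ∈ Submodule.span ℂ (v '' S)
      induction hw using Submodule.span_induction with
      | mem w hw =>
        obtain ⟨t, ht, rfl⟩ := hw
        exact lie_mem_of_gen _ (fun g => h g t ht) x
      | zero => simp
      | add w w' _ _ h1 h2 =>
        rw [lie_add]
        exact Submodule.add_mem _ h1 h2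
      | smul c w _ h1 =>
        rw [lie_smul]
        exact Submodule.smul_mem _ c h1 }

theorem Indecomposable.eq_empty_or_univ (hind : Indecomposable V) (v : Module.Basis ℤ ℂ V)
    (S : Set ℤ) (h1 : ∀ g, ∀ x ∈ S, ⁅gen g, v x⁆ ∈ Submodule.span ℂ (v '' S))
    (h2 : ∀ g, ∀ x ∈ Sᶜ, ⁅gen g, v x⁆ ∈ Submodule.span ℂ (v '' Sᶜ)) :
    S = ∅ ∨ S = Set.univ := by
  have hc : IsCompl (spanSubmodule v S h1) (spanSubmodule v Sᶜ h2) := by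
    rw [← LieSubmodule.isCompl_toSubmodule]
    constructor
    · exact v.linearIndependent.disjoint_span_image disjoint_compl_right
    · rw [codisjoint_iff]
      change Submodule.span ℂ (v '' S) ⊔ Submodule.span ℂ (v '' Sᶜ) = ⊤
      rw [← Submodule.span_union, ← Set.image_union, Set.union_compl_self, Set.image_univ,
        v.span_eq]
  have key : ∀ (S : Set ℤ) h, spanSubmodule v S h = ⊥ → S = ∅ := by
    intro S h hb
    refine Set.eq_empty_iff_forall_notMem.mpr fun x hx => v.ne_zero x ?_
    have : v x ∈ spanSubmodule v S h := Submodule.subset_span ⟨x, hx, rfl⟩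
    rwa [hb, LieSubmodule.mem_bot] at this
  rcases hind.2 _ _ hc with h | h
  · exact .inl (key _ _ h)
  · exact .inr (Set.compl_empty_iff.mp (key _ _ h))

theorem exists_rep (v : Module.Basis ℤ ℂ V)
    (hgr : ∀ (m n : ℤ), ∀ x ∈ component m, ⁅x, v n⁆ ∈ Submodule.span ℂ {v (m + n)})
    (hind : Indecomposable V) :
    ∃ (K J : ℤ → ℤ → ℂ) (a κ lam mu c : ℂ), Rep K J a κ lam mu c ∧ IsConnected K J ∧
      (∀ m n, ⁅gen (.L m), v n⁆ = K n (m + n) • v (m + n)) ∧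
      (∀ m n, ⁅gen (.I m), v n⁆ = J n (m + n) • v (m + n)) ∧
      (∀ n, ⁅gen .CL, v n⁆ = κ • v n) ∧ (∀ n, ⁅gen .CI, v n⁆ = mu • v n) ∧
      (∀ n, ⁅gen .CLI, v n⁆ = lam • v n) := by
  obtain ⟨K, J, κ, μ, lam, hK, hJ, hκ, hμ, hlam⟩ := exists_structure_constants v hgr
  have cancel : ∀ {x : ℤ} {r s : ℂ}, r • v x = s • v x → r = s := fun {x r s} h =>
    smul_left_injective ℂ (v.ne_zero x) h
  have hcon : IsConnected K J := by
    intro S hS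
    have key : ∀ S : Set ℤ, (∀ x y, K x y ≠ 0 ∨ J x y ≠ 0 → x ∈ S → y ∈ S) →
        ∀ g, ∀ x ∈ S, ⁅gen g, v x⁆ ∈ Submodule.span ℂ (v '' S) := by
      intro S hS g x hx
      have mem : ∀ (r : ℂ) (y : ℤ), (r ≠ 0 → y ∈ S) → r • v y ∈ Submodule.span ℂ (v '' S) := by
        intro r y hy
        rcases eq_or_ne r 0 with rfl | hr
        · simp
        · exact Submodule.smul_mem _ _ (Submodule.subset_span ⟨y, hy hr, rfl⟩)
      rcases g with m | m | _ | _ | _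
      · rw [hK]
        exact mem _ _ fun h => hS _ _ (.inl h) hx
      · rw [hJ]
        exact mem _ _ fun h => hS _ _ (.inr h) hx
      · rw [hκ]
        exact mem _ _ fun _ => hx
      · rw [hμ]
        exact mem _ _ fun _ => hx
      · rw [hlam]
        exact mem _ _ fun _ => hx
    exact hind.eq_empty_or_univ v S (key S fun x y h => (hS x y h).mp)
      (key Sᶜ fun x y h => mt (hS x y h).mpr)
  -- A function preserved by all nonzero arrows is constant by connectedness; this takes the place
  -- of Schur's lemma.
  have const : ∀ Φ : ℤ → ℂ, (∀ x y, K x y ≠ 0 ∨ J x y ≠ 0 → Φ x = Φ y) → ∀ x, Φ x = Φ 0 := by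
    intro Φ hΦ x
    have := (hcon {x | Φ x = Φ 0} fun x y h => by simp [hΦ x y h]).resolve_left
      (Set.Nonempty.ne_empty ⟨0, rfl⟩)
    exact Set.eq_univ_iff_forall.mp this x
  have hLL : ∀ m n t : ℤ, K t (n + t) * K (n + t) (m + (n + t)) -
      K t (m + t) * K (m + t) (m + (n + t)) = ((n : ℂ) - m) * K t (m + (n + t)) +
        if m + n = 0 then ((m : ℂ) ^ 3 - m) / 12 * κ t else 0 := by
    intro m n t
    have e := lie_genBracket (.L m) (.L n) (v t)
    simp only [genBracket, add_lie, smul_lie, hK, lie_smul, smul_smul, ← add_assoc,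
      add_comm n m] at e
    simp only [← add_assoc]
    apply cancel (x := m + n + t)
    split_ifs at e ⊢ with h0
    · rw [smul_lie, hκ, smul_smul] at e
      rw [h0, zero_add] at e ⊢
      rw [sub_smul, add_smul, ← e]
    · rw [zero_lie, add_zero] at e
      rw [sub_smul, add_zero, ← e]
  have hLI : ∀ m n t : ℤ, J t (n + t) * K (n + t) (m + (n + t)) -
      K t (m + t) * J (m + t) (m + (n + t)) = (n : ℂ) * J t (m + (n + t)) +
        if m + n = 0 then ((m : ℂ) ^ 2 - m) * lam t else 0 := by
    intro m n t
    have e := lie_genBracket (.L m) (.I n) (v t)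
    simp only [genBracket, add_lie, smul_lie, hK, hJ, lie_smul, smul_smul, ← add_assoc,
      add_comm n m] at e
    simp only [← add_assoc]
    apply cancel (x := m + n + t)
    split_ifs at e ⊢ with h0
    · rw [smul_lie, hlam, smul_smul] at e
      rw [h0, zero_add] at e ⊢
      rw [sub_smul, add_smul, ← e]
    · rw [zero_lie, add_zero] at e
      rw [sub_smul, add_zero, ← e]
  have hII : ∀ m n t : ℤ, J t (n + t) * J (n + t) (m + (n + t)) -
      J t (m + t) * J (m + t) (m + (n + t)) = if m + n = 0 then (n : ℂ) * μ t else 0 := by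
    intro m n t
    have e := lie_genBracket (.I m) (.I n) (v t)
    simp only [genBracket, hJ, lie_smul, smul_smul, ← add_assoc, add_comm n m] at e
    simp only [← add_assoc]
    apply cancel (x := m + n + t)
    split_ifs at e ⊢ with h0
    · rw [smul_lie, hμ, smul_smul] at e
      rw [h0, zero_add] at e ⊢
      rw [sub_smul, ← e]
    · rw [zero_lie] at e
      rw [sub_smul, ← e, zero_smul]
  have central : ∀ (g : Gen) (f : ℤ → ℂ), (∀ n, ⁅gen g, v n⁆ = f n • v n) →
      (∀ h, genBracket g h = 0) → ∀ x, f x = f 0 := by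
    intro g f hf hg
    refine const f fun x y hxy => ?_
    have aux : ∀ (h : Gen) (r : ℂ), r ≠ 0 → ⁅gen h, v x⁆ = r • v y → f x = f y := by
      intro h r hr e
      have e1 := lie_genBracket g h (v x)
      rw [hg, zero_lie, e, hf, lie_smul, lie_smul, hf, e, smul_smul, smul_smul, eq_comm,
        sub_eq_zero] at e1
      refine mul_left_cancel₀ hr ?_
      linear_combination -cancel e1
    rcases hxy with h0 | h0
    · exact aux (.L (y - x)) _ h0 (by rw [hK, sub_add_cancel])
    · exact aux (.I (y - x)) _ h0 (by rw [hJ, sub_add_cancel])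
  have hκ0 := central .CL κ hκ fun h => by cases h <;> rfl
  have hμ0 := central .CI μ hμ fun h => by cases h <;> rfl
  have hlam0 := central .CLI lam hlam fun h => by cases h <;> rfl
  -- I(0) is central too: the brackets carry the factor n = 0, and the C_LI-term m² - m is needed
  -- only at m = 0.
  have hJ0 : ∀ x, J x x = J 0 0 := by
    refine central (.I 0) (fun x => J x x) (fun n => by rw [hJ, zero_add]) fun h => ?_
    cases h <;> simp +contextual [genBracket]
  -- L(0) is not central, but its bracket with a homogeneous element of degree n multiplies it by n,
  -- which subtracting the degree x compensates.
  have hK0 : ∀ x : ℤ, K x x - x = K 0 0 - (0 : ℤ) := by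
    refine const (fun x => K x x - x) fun x y hxy => ?_
    rcases hxy with h0 | h0
    · have e := hLL 0 (y - x) x
      simp only [sub_add_cancel, zero_add] at e
      refine mul_left_cancel₀ h0 ?_
      push_cast at e
      split_ifs at e <;> linear_combination -e
    · have e := hLI 0 (y - x) x
      simp only [sub_add_cancel, zero_add] at e
      refine mul_left_cancel₀ h0 ?_
      push_cast at e
      split_ifs at e <;> linear_combination -e
  refine ⟨K, J, K 0 0, κ 0, lam 0, μ 0, J 0 0, ⟨fun x => ?_, hJ0, fun x y y' z e => ?_,
    fun x y y' z e => ?_, fun x y y' z e => ?_⟩, hcon, hK, hJ, fun n => ?_, fun n => ?_,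
    fun n => ?_⟩
  · have := hK0 x
    push_cast at this
    linear_combination this
  · have := hLL (y' - x) (y - x) x
    have hz : y' - x + (y - x + x) = z := by omega
    rw [hz, sub_add_cancel, sub_add_cancel, hκ0] at this
    rw [this, if_congr (show y' - x + (y - x) = 0 ↔ x = z by omega) rfl rfl]
    push_cast
    congr 1
    ring
  · have := hLI (y' - x) (y - x) x
    have hz : y' - x + (y - x + x) = z := by omega
    rw [hz, sub_add_cancel, sub_add_cancel, hlam0] at this
    rw [this, if_congr (show y' - x + (y - x) = 0 ↔ x = z by omega) rfl rfl]
    push_cast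
    rfl
  · have := hII (y' - x) (y - x) x
    have hz : y' - x + (y - x + x) = z := by omega
    rw [hz, sub_add_cancel, sub_add_cancel, hμ0] at this
    rw [this, if_congr (show y' - x + (y - x) = 0 ↔ x = z by omega) rfl rfl]
    push_cast
    rfl
  · rw [hκ, hκ0]
  · rw [hμ, hμ0]
  · rw [hlam, hlam0]

/-- A module with the structure constants of `k` is isomorphic to the module given by `k`. -/
theorem Matches.nonempty_equiv {k : Coeffs} {K J : ℤ → ℤ → ℂ} (h : Matches k K J)
    (v : Module.Basis ℤ ℂ V)
    (hL : ∀ m n, ⁅gen (.L m), v n⁆ = K n (m + n) • v (m + n))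
    (hI : ∀ m n, ⁅gen (.I m), v n⁆ = J n (m + n) • v (m + n))
    (hCL : ∀ n, ⁅gen .CL, v n⁆ = 0) (hCI : ∀ n, ⁅gen .CI, v n⁆ = 0)
    (hCLI : ∀ n, ⁅gen .CLI, v n⁆ = 0) : Nonempty (V ≃ₗ⁅ℂ, HV⁆ k.Mod) := by
  obtain ⟨o, g, hg, H⟩ := h
  set w : Module.Basis ℤ ℂ V :=
    (v.reindex (Equiv.subRight o)).isUnitSMul fun x => (hg x).isUnit with hw
  have hwx : ∀ x, w x = g x • v (x + o) := fun x => by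
    rw [hw, Module.Basis.isUnitSMul_apply]
    simp
  set e : V ≃ₗ[ℂ] k.Mod := w.repr with he
  have hew : ∀ x, e (w x) = k.vec x := fun x => w.repr_self x
  have hLw : ∀ n x, ⁅gen (.L n), w x⁆ = k.l n x • w (n + x) := fun n x => by
    have := (H x (n + x)).1
    rw [add_sub_cancel_right] at this
    rw [hwx, hwx, lie_smul, hL, smul_smul, smul_smul, ← this, mul_comm, add_assoc]
  have hIw : ∀ n x, ⁅gen (.I n), w x⁆ = k.i n x • w (n + x) := fun n x => by
    have := (H x (n + x)).2
    rw [add_sub_cancel_right] at this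
    rw [hwx, hwx, lie_smul, hI, smul_smul, smul_smul, ← this, mul_comm, add_assoc]
  have hact : ∀ (s : Gen) (u : k.Mod), ⁅gen s, u⁆ = k.genAct s u := fun s u =>
    congrArg (fun f : Module.End ℂ k.Mod => f u) (k.act_gen s)
  have hgen : ∀ s x, e ⁅gen s, w x⁆ = ⁅gen s, e (w x)⁆ := by
    intro s x
    rw [hact, hew]
    rcases s with n | n | _ | _ | _
    · rw [hLw, map_smul, hew]
      exact (k.lift_vec (fun t => k.l n t • k.vec (n + t)) x).symm
    · rw [hIw, map_smul, hew]
      exact (k.lift_vec (fun t => k.i n t • k.vec (n + t)) x).symm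
    · rw [hwx, lie_smul, hCL, smul_zero, map_zero]
      rfl
    · rw [hwx, lie_smul, hCI, smul_zero, map_zero]
      rfl
    · rw [hwx, lie_smul, hCLI, smul_zero, map_zero]
      rfl
  have hlie : ∀ (x : HV) (u : V), e ⁅x, u⁆ = ⁅x, e u⁆ := by
    intro x u
    induction x using gen_induction with
    | zero => simp
    | add x y hx hy => rw [add_lie, map_add, hx, hy, add_lie]
    | smul c s =>
      rw [smul_lie, map_smul, smul_lie]
      congr 1
      exact LinearMap.congr_fun (w.ext (f₁ := e.toLinearMap ∘ₗ LieModule.toEnd ℂ HV V (gen s))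
        (f₂ := LieModule.toEnd ℂ HV k.Mod (gen s) ∘ₗ e.toLinearMap) (hgen s)) u
  exact ⟨{ e with map_lie' := fun {x u} => hlie x u }⟩

end Module

end TwistedHV

theorem theorem3p5 {V : Type*} [AddCommGroup V] [Module ℂ V]
    [LieRingModule TwistedHV.HV V] [LieModule ℂ TwistedHV.HV V]
    (v : Module.Basis ℤ ℂ V)
    (hgr : ∀ (m n : ℤ), ∀ x ∈ TwistedHV.component m, ⁅x, v n⁆ ∈ Submodule.span ℂ {v (m + n)})
    (hind : TwistedHV.Indecomposable V) :
    ((∃ a b c : ℂ, Nonempty (V ≃ₗ⁅ℂ, TwistedHV.HV⁆ (TwistedHV.modA a b c).Mod)) ∨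
      (∃ a d : ℂ, Nonempty (V ≃ₗ⁅ℂ, TwistedHV.HV⁆ (TwistedHV.modAd a d).Mod)) ∨
      (∃ a d : ℂ, Nonempty (V ≃ₗ⁅ℂ, TwistedHV.HV⁆ (TwistedHV.modB a d).Mod)) ∨
      (∃ d : ℂ, Nonempty (V ≃ₗ⁅ℂ, TwistedHV.HV⁆ (TwistedHV.modU d).Mod)) ∨
      (∃ d : ℂ, Nonempty (V ≃ₗ⁅ℂ, TwistedHV.HV⁆ (TwistedHV.modV d).Mod)) ∨
      (∃ d : ℂ, d ≠ 0 ∧ Nonempty (V ≃ₗ⁅ℂ, TwistedHV.HV⁆ (TwistedHV.modUtilde d).Mod)) ∨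
      (∃ c : ℂ, c ≠ 0 ∧ Nonempty (V ≃ₗ⁅ℂ, TwistedHV.HV⁆ (TwistedHV.modVtilde c).Mod))) ∧
    ∀ w : V, ⁅TwistedHV.gen .CL, w⁆ = 0 ∧ ⁅TwistedHV.gen .CI, w⁆ = 0 ∧
      ⁅TwistedHV.gen .CLI, w⁆ = 0 := by
  obtain ⟨K, J, a, κ, lam, mu, c, hrep, hcon, hL, hI, hCL, hCI, hCLI⟩ :=
    TwistedHV.exists_rep v hgr hind
  obtain ⟨rfl, rfl, rfl, hcl⟩ := hrep.classified hcon
  simp only [zero_smul] at hCL hCI hCLI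
  have iso : ∀ k : TwistedHV.Coeffs, TwistedHV.Matches k K J →
      Nonempty (V ≃ₗ⁅ℂ, TwistedHV.HV⁆ k.Mod) := fun k hk =>
    hk.nonempty_equiv v hL hI hCL hCI hCLI
  have zero : ∀ g : TwistedHV.Gen, (∀ n, ⁅TwistedHV.gen g, v n⁆ = 0) →
      ∀ w : V, ⁅TwistedHV.gen g, w⁆ = 0 := fun g hg w =>
    LinearMap.congr_fun (v.ext (f₁ := LieModule.toEnd ℂ TwistedHV.HV V (TwistedHV.gen g))
      (f₂ := 0) hg) w
  refine ⟨?_, fun w => ⟨zero _ hCL w, zero _ hCI w, zero _ hCLI w⟩⟩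
  exact hcl.imp (fun ⟨a, b, c, h⟩ => ⟨a, b, c, iso _ h⟩) <|
    .imp (fun ⟨a, d, h⟩ => ⟨a, d, iso _ h⟩) <| .imp (fun ⟨a, d, h⟩ => ⟨a, d, iso _ h⟩) <|
    .imp (fun ⟨d, h⟩ => ⟨d, iso _ h⟩) <| .imp (fun ⟨d, h⟩ => ⟨d, iso _ h⟩) <|
    .imp (fun ⟨d, hd, h⟩ => ⟨d, hd, iso _ h⟩) fun ⟨c, hd, h⟩ => ⟨c, hd, iso _ h⟩
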